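/- Fix a dimension $d \ge 1$ and a horizon $T \ge 1$. In each round $t = 1, \dots, T$ a learner plays a unit vector $w_t \in \mathbb{R}^d$, an environment chooses a symmetric matrix $L_t \in \mathbb{R}^{d\times d}$ of spectral norm at most $1$, and the learner observes only its loss $\ell_t = \operatorname{tr}(w_t w_t^{\top} L_t)$. The environment may be adaptive and randomized: $L_t$ may depend on everything that happened before $w_t$ is drawn, but given this history it does not depend on the draw of $w_t$. The learner runs the following algorithm (online mirror descent with the regularizer $-\log\det$ and sparse sampling) with parameters $\eta > 0$ and $\gamma \in [0,1]$. Start with $W_1 = I/d$. In round $t$, take an eigendecomposition $W_t = \sum_{i=1}^d \mu_i u_i u_i^{\top}$ with an orthonormal basis $u_1, \dots, u_d$ and put $\lambda_i = (1-\gamma)\mu_i + \gamma/d$. Given the past, draw indices $I, J$ independently with probabilities $\lambda_1, \dots, \lambda_d$. If $I = J$, play $w_t = u_I$ and set $\widetilde L_t = \frac{\ell_t}{\lambda_I^2} u_I u_I^{\top}$; if $I \ne J$, draw a uniform sign $s \in \{-1, 1\}$, play $w_t = \frac{1}{\sqrt 2}(u_I + s u_J)$ and set $\widetilde L_t = \frac{s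 \ell_t}{2\lambda_I\lambda_J}(u_I u_J^{\top} + u_J u_I^{\top})$. Then let $W_{t+1} = (W_t^{-1} + \eta \widetilde L_t + \beta I)^{-1}$, where $\beta \in \mathbb{R}$ is such that $W_{t+1}$ is positive definite with $\operatorname{tr}(W_{t+1}) = 1$. Let $\mathrm{regret}_T = \max_{\|u\| = 1} \sum_{t=1}^T \mathbb{E}\bigl[\operatorname{tr}\bigl((w_t w_t^{\top} - u u^{\top}) L_t\bigr)\bigr]$. **Theorem.** If $0 < \eta \le \frac{1}{2d}$ and $\gamma = \eta d$, then $$\mathrm{regret}_T \le \frac{d \log T}{\eta} + 2 \eta d T + 2 + 8 \eta d \sum_{t=1}^T \mathbb{E}\bigl[\|L_t\|_F^2\bigr].$$ -/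

import Mathlib

open MeasureTheory

namespace BanditPCA

/-- The space `ℝ^d` with its Euclidean norm. -/
abbrev Vec (d : ℕ) : Type := EuclideanSpace ℝ (Fin d)

/-- Real `d × d` matrices. -/
abbrev Mat (d : ℕ) : Type := Matrix (Fin d) (Fin d) ℝ

/-- The outer product `x yᵀ`. -/
def outer {d : ℕ} (x y : Vec d) : Mat d := Matrix.vecMulVec x.ofLp y.ofLp

/-- The matrix inner product `⟨A, B⟩ = tr(Aᵀ B)`. -/
def frobInner {d : ℕ} (A B : Mat d) : ℝ := (A.transpose * B).trace

/-- The Frobenius norm `‖A‖_F = √⟨A, A⟩`. -/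
noncomputable def frobNorm {d : ℕ} (A : Mat d) : ℝ := Real.sqrt (frobInner A A)

/-- The spectral norm: the operator norm of `A` on Euclidean space. -/
noncomputable def spectralNorm {d : ℕ} (A : Mat d) : ℝ :=
  ‖Matrix.toEuclideanCLM (𝕜 := ℝ) (n := Fin d) A‖

/-- The sampling weights `λ = (1 - γ) μ + γ (1/d, …, 1/d)`. -/
noncomputable def mixWeights {d : ℕ} (γ : ℝ) (μ : Fin d → ℝ) (i : Fin d) : ℝ :=
  (1 - γ) * μ i + γ * (1 / (d : ℝ))

/-- The vector played by sparse sampling for drawn indices `i, j` and sign `s`: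
`u_i` if `i = j`, and `(u_i + s u_j) / √2` otherwise. -/
noncomputable def sparseAction {d : ℕ} (u : OrthonormalBasis (Fin d) ℝ (Vec d))
    (i j : Fin d) (s : ℝ) : Vec d :=
  if i = j then u i else (1 / Real.sqrt 2) • (u i + s • u j)

/-- The loss estimate of sparse sampling, where `l` is the observed loss:
`(l / λ_i²) u_i u_iᵀ` if `i = j`, and `(s l / (2 λ_i λ_j)) (u_i u_jᵀ + u_j u_iᵀ)` otherwise. -/
noncomputable def sparseEstimate {d : ℕ} (u : OrthonormalBasis (Fin d) ℝ (Vec d))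
    (lam : Fin d → ℝ) (i j : Fin d) (s l : ℝ) : Mat d :=
  if i = j then (l / lam i ^ 2) • outer (u i) (u i)
  else (s * l / (2 * lam i * lam j)) • (outer (u i) (u j) + outer (u j) (u i))

/-- One step of online mirror descent with the regularizer `- log det` over density matrices:
`W'` is the positive definite matrix of unit trace of the form `(W⁻¹ + η Lhat + β I)⁻¹`,
with a real number `β`. -/
def IsUpdate {d : ℕ} (η : ℝ) (W Lhat W' : Mat d) : Prop :=
  W'.PosDef ∧ W'.trace = 1 ∧ ∃ β : ℝ, W' = (W⁻¹ + η • Lhat + β • (1 : Mat d))⁻¹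

/-- The step is always possible. -/
theorem exists_isUpdate {d : ℕ} (hd : 0 < d) (η : ℝ) {W Lhat : Mat d}
    (hW : W.PosDef) (hL : Lhat.IsSymm) : ∃ W', IsUpdate η W Lhat W' := by
  have : Nonempty (Fin d) := ⟨⟨0, hd⟩⟩
  have hA : (W⁻¹ + η • Lhat).IsHermitian := by
    refine hW.inv.isHermitian.add ?_
    show (η • Lhat).conjTranspose = η • Lhat
    rw [Matrix.conjTranspose_smul, Matrix.conjTranspose_eq_transpose_of_trivial, hL.eq]
    simp
  set A := W⁻¹ + η • Lhat with hAdef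
  obtain ⟨i₀, hi₀⟩ := Finite.exists_min hA.eigenvalues
  set a := hA.eigenvalues with ha
  have hpos : ∀ x : ℝ, 1 ≤ x → ∀ i, 0 < a i + (x - a i₀) := fun x hx i => by
    have := hi₀ i
    linarith
  let f : ℝ → ℝ := fun x => ∑ i, (a i + (x - a i₀))⁻¹
  have hd1 : (1 : ℝ) ≤ d := by exact_mod_cast hd
  have hf : ContinuousOn f (Set.Icc 1 (d : ℝ)) := by
    refine continuousOn_finsetSum _ fun i _ => ContinuousOn.inv₀ (by fun_prop) ?_
    intro x hx
    exact (hpos x hx.1 i).ne'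
  have h1 : 1 ≤ f 1 := by
    have := Finset.single_le_sum (f := fun i => (a i + (1 - a i₀))⁻¹)
      (fun i _ => (inv_pos.2 (hpos 1 le_rfl i)).le) (Finset.mem_univ i₀)
    simpa [f] using this
  have h2 : f d ≤ 1 := by
    have : f d ≤ ∑ _i : Fin d, (d : ℝ)⁻¹ := by
      refine Finset.sum_le_sum fun i _ => ?_
      have := hi₀ i
      exact inv_anti₀ (by linarith) (by linarith)
    refine this.trans ?_
    have hd0 : (d : ℝ) ≠ 0 := by positivity
    simp [hd0]
  obtain ⟨x, hx, hfx⟩ := intermediate_value_Icc' hd1 hf ⟨h2, h1⟩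
  set β := x - a i₀ with hβ
  let U := hA.eigenvectorUnitary
  have hUU : (U : Mat d) * star (U : Mat d) = 1 := Unitary.coe_mul_star_self U
  have hUU' : star (U : Mat d) * (U : Mat d) = 1 := Unitary.coe_star_mul_self U
  have hspec : A = (U : Mat d) * Matrix.diagonal a * star (U : Mat d) := by
    have := hA.spectral_theorem
    rw [Unitary.conjStarAlgAut_apply] at this
    simpa using this
  have hsum : A + β • (1 : Mat d) =
      (U : Mat d) * Matrix.diagonal (fun i => a i + β) * star (U : Mat d) := by
    have : Matrix.diagonal (fun i => a i + β) = Matrix.diagonal a + β • (1 : Mat d) := by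
      rw [← Matrix.diagonal_one, ← Matrix.diagonal_smul, Matrix.diagonal_add]
      simp
    rw [this, mul_add, add_mul, ← hspec]
    simp [hUU]
  have hPD : (A + β • (1 : Mat d)).PosDef := by
    rw [hsum]
    refine (Matrix.IsUnit.posDef_star_right_conjugate_iff
      ⟨⟨(U : Mat d), star (U : Mat d), hUU, hUU'⟩, rfl⟩).2 ?_
    exact Matrix.PosDef.diagonal fun i => hpos x hx.1 i
  have hinv : (A + β • (1 : Mat d))⁻¹ =
      (U : Mat d) * Matrix.diagonal (fun i => (a i + β)⁻¹) * star (U : Mat d) := by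
    refine Matrix.inv_eq_right_inv ?_
    rw [hsum]
    have hdd : Matrix.diagonal (fun i => a i + β) * Matrix.diagonal (fun i => (a i + β)⁻¹)
        = (1 : Mat d) := by
      rw [Matrix.diagonal_mul_diagonal, ← Matrix.diagonal_one]
      congr 1
      funext i
      exact mul_inv_cancel₀ (hpos x hx.1 i).ne'
    calc _ = (U : Mat d) * (Matrix.diagonal (fun i => a i + β) * (star (U : Mat d) * (U : Mat d))
          * Matrix.diagonal (fun i => (a i + β)⁻¹)) * star (U : Mat d) := by
            simp only [mul_assoc]
      _ = 1 := by rw [hUU', mul_one, hdd, mul_one, hUU]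
  refine ⟨(A + β • (1 : Mat d))⁻¹, hPD.inv, ?_, β, rfl⟩
  rw [hinv, Matrix.trace_mul_comm, ← mul_assoc, hUU', one_mul, Matrix.trace_diagonal]
  exact hfx

/-- The losses of an environment in rounds `1, …, T`. `ℱ t` is the information available in round
`t` before the learner draws its action; the loss matrix of round `t` may depend on all of it
(and on private randomness of the environment, which `ℱ t` may contain),
is symmetric and has spectral norm at most one. -/
structure IsLossSequence {Ω : Type*} {mΩ : MeasurableSpace Ω} {d : ℕ} (ℱ : Filtration ℕ mΩ)
    (T : ℕ) (L : ℕ → Ω → Mat d) : Prop where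
  adapted : ∀ t ∈ Finset.Icc 1 T, ∀ i j, Measurable[ℱ t] fun ω => L t ω i j
  symm : ∀ t ∈ Finset.Icc 1 T, ∀ ω, (L t ω).IsSymm
  bounded : ∀ t ∈ Finset.Icc 1 T, ∀ ω, spectralNorm (L t ω) ≤ 1

/-- `T` rounds of the algorithm with learning rate `η`, exploration rate `γ` and sparse sampling,
against the losses `L`. -/
structure SparseRun {Ω : Type*} {mΩ : MeasurableSpace Ω} {d : ℕ} (P : Measure Ω)
    (ℱ : Filtration ℕ mΩ) (T : ℕ) (η γ : ℝ) (L : ℕ → Ω → Mat d) where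
  /-- The density matrices. -/
  W : ℕ → Ω → Mat d
  /-- The eigenvalues of `W t`. -/
  μ : ℕ → Ω → Fin d → ℝ
  /-- The eigenvectors of `W t`. -/
  u : ℕ → Ω → OrthonormalBasis (Fin d) ℝ (Vec d)
  /-- The first drawn index. -/
  I : ℕ → Ω → Fin d
  /-- The second drawn index. -/
  J : ℕ → Ω → Fin d
  /-- The drawn sign (it plays no role if the two indices agree). -/
  s : ℕ → Ω → ℝ
  init : ∀ ω, W 1 ω = (1 / (d : ℝ)) • (1 : Mat d)
  /-- Any eigendecomposition of `W t` may be used, … -/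
  eigen : ∀ t ∈ Finset.Icc 1 T, ∀ ω,
    W t ω = ∑ i, μ t ω i • outer (u t ω i) (u t ω i)
  /-- … chosen on the basis of the past. -/
  measurable_μ : ∀ t ∈ Finset.Icc 1 T, ∀ i, Measurable[ℱ t] fun ω => μ t ω i
  measurable_u : ∀ t ∈ Finset.Icc 1 T, ∀ i, Measurable[ℱ t] fun ω => u t ω i
  /-- The draws of round `t` belong to the history of round `t + 1`. -/
  measurable_I : ∀ t ∈ Finset.Icc 1 T, Measurable[ℱ (t + 1)] (I t)
  measurable_J : ∀ t ∈ Finset.Icc 1 T, Measurable[ℱ (t + 1)] (J t)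
  measurable_s : ∀ t ∈ Finset.Icc 1 T, Measurable[ℱ (t + 1)] (s t)
  sign : ∀ t ∈ Finset.Icc 1 T, ∀ ω, s t ω = -1 ∨ s t ω = 1
  /-- Given the past, `I` and `J` are drawn independently from the weights `λ`, and the sign
  is uniform and independent of them. -/
  draw : ∀ t ∈ Finset.Icc 1 T, ∀ i j : Fin d, ∀ σ : ℝ, σ = -1 ∨ σ = 1 →
    P[Set.indicator {ω | I t ω = i ∧ J t ω = j ∧ s t ω = σ} (fun _ => (1 : ℝ)) | ℱ t]
      =ᵐ[P] fun ω => mixWeights γ (μ t ω) i * mixWeights γ (μ t ω) j * (1 / 2)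
  /-- The update, from the loss `⟨w wᵀ, L t⟩` observed for the action `w` that is played. -/
  update : ∀ t ∈ Finset.Icc 1 T, ∀ ω,
    IsUpdate η (W t ω)
      (sparseEstimate (u t ω) (mixWeights γ (μ t ω)) (I t ω) (J t ω) (s t ω)
        (frobInner (outer (sparseAction (u t ω) (I t ω) (J t ω) (s t ω))
          (sparseAction (u t ω) (I t ω) (J t ω) (s t ω))) (L t ω)))
      (W (t + 1) ω)

/-- The unit vector played in round `t`. -/
noncomputable def SparseRun.action {Ω : Type*} {mΩ : MeasurableSpace Ω} {d : ℕ} {P : Measure Ω}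
    {ℱ : Filtration ℕ mΩ} {T : ℕ} {η γ : ℝ} {L : ℕ → Ω → Mat d}
    (R : SparseRun P ℱ T η γ L) (t : ℕ) (ω : Ω) : Vec d :=
  sparseAction (R.u t ω) (R.I t ω) (R.J t ω) (R.s t ω)

/-- The total expected regret against the fixed vector `v`:
`∑_{t=1}^T 𝔼 ⟨w_t w_tᵀ - v vᵀ, L_t⟩`. -/
noncomputable def regretAgainst {Ω : Type*} [MeasurableSpace Ω] {d : ℕ} (P : Measure Ω) (T : ℕ)
    (w : ℕ → Ω → Vec d) (L : ℕ → Ω → Mat d) (v : Vec d) : ℝ :=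
  ∑ t ∈ Finset.Icc 1 T, ∫ ω, frobInner (outer (w t ω) (w t ω) - outer v v) (L t ω) ∂P

/-- The regret: the supremum over all unit vectors `v` of the regret against `v`. -/
noncomputable def regret {Ω : Type*} [MeasurableSpace Ω] {d : ℕ} (P : Measure Ω) (T : ℕ)
    (w : ℕ → Ω → Vec d) (L : ℕ → Ω → Mat d) : ℝ :=
  ⨆ v : Metric.sphere (0 : Vec d) 1, regretAgainst P T w L v

end BanditPCA

namespace BanditPCA

open Matrix MatrixOrder

/-! ### The log-determinant divergence and one mirror descent step -/

section

variable {d : ℕ}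

/-! The proof is the mirror descent analysis for `-log det`, with the estimates studied in the
eigenbasis of `W t`. The divergence is nonnegative because `log x ≤ x - 1` on eigenvalues
(`log_det_add_log_det_le`). Hence one update pays for `η tr((W - U) L̃)` with a drop of `potential
U` plus the divergence from `W` to the unnormalised iterate `(W⁻¹ + η L̃)⁻¹` (`mirror_step`); the
multiplier `β` cancels because iterate and comparator both have trace one.

In the eigenbasis the estimate touches a single diagonal entry or one symmetric pair, so the local
divergence has a closed form: `x - log (1 + x)` or `-log (1 - y)`. The exploration share `γ / d = η`
forces `2 η μ_i ≤ λ_i²`, which keeps `x` and `y` in the range where these are quadratically small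
(`posDef_and_divergence_le`).

Averaging over the draws, the estimate is unbiased (`mean_estimateCoeff_mul`) and its quadratic term
is at most `8 d ‖L_t‖_F²` (`mean_quadratic_le`).

A rank-one comparator has infinite divergence, so `v vᵀ` is mixed with `I / d` at rate `θ = 1 / T`.
The potential then drops by at most `d log T` in total; the mixing costs at most `2 θ` per round,
hence `2` overall, and exploration at most `2 γ = 2 η d` per round. -/

theorem log_det_le_trace_sub {M : Mat d} (hM : M.PosDef) :
    Real.log M.det ≤ M.trace - d := by
  have h1 : M.det = ∏ i, hM.isHermitian.eigenvalues i := by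
    simpa using hM.isHermitian.det_eq_prod_eigenvalues
  have h2 : M.trace = ∑ i, hM.isHermitian.eigenvalues i := by
    simpa using hM.isHermitian.trace_eq_sum_eigenvalues
  rw [h1, h2, Real.log_prod fun i _ => (hM.eigenvalues_pos i).ne']
  calc ∑ i, Real.log (hM.isHermitian.eigenvalues i)
      ≤ ∑ i, (hM.isHermitian.eigenvalues i - 1) :=
        Finset.sum_le_sum fun i _ => Real.log_le_sub_one_of_pos (hM.eigenvalues_pos i)
    _ = _ := by simp [Finset.sum_sub_distrib]

/-- Nonnegativity of the log-determinant divergence between `X` and `Y⁻¹`. Since `X * Y` need not be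
symmetric, write `Y = Cᴴ C` and apply the one-matrix bound to `C X Cᴴ`, which has the same trace and
determinant. -/
theorem log_det_add_log_det_le {X Y : Mat d} (hX : X.PosDef) (hY : Y.PosDef) :
    Real.log X.det + Real.log Y.det ≤ (X * Y).trace - d := by
  obtain ⟨C, hC⟩ := CStarAlgebra.nonneg_iff_eq_star_mul_self.1 hY.posSemidef.nonneg
  rw [star_eq_conjTranspose] at hC
  have hdet : Y.det = C.det * C.det := by
    rw [hC, Matrix.det_mul, Matrix.det_conjTranspose]; simp
  have hC0 : C.det ≠ 0 := fun h => hY.det_pos.ne' (by simp [hdet, h])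
  have hCu : IsUnit C := (Matrix.isUnit_iff_isUnit_det C).2 (isUnit_iff_ne_zero.2 hC0)
  have hM : (C * X * Cᴴ).PosDef := by
    have := (Matrix.IsUnit.posDef_star_right_conjugate_iff (x := X) hCu).2 hX
    simpa [Matrix.star_eq_conjTranspose] using this
  have := log_det_le_trace_sub hM
  rw [Matrix.det_mul, Matrix.det_mul, Matrix.det_conjTranspose] at this
  rw [← Real.log_mul hX.det_pos.ne' hY.det_pos.ne', hdet]
  have e : (C * X * Cᴴ).trace = (X * Y).trace := by
    rw [hC, mul_assoc, Matrix.trace_mul_comm, mul_assoc]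
  rw [e] at this
  convert this using 2
  simp; ring

/-- The potential of the comparator `U` at `W`: the log-determinant divergence up to constants. -/
noncomputable def potential (U W : Mat d) : ℝ := (W⁻¹ * U).trace + Real.log W.det

theorem inv_eq_of_isUpdate {η β : ℝ} {W Lhat W' : Mat d} (hW' : W'.PosDef)
    (h : W' = (W⁻¹ + η • Lhat + β • (1 : Mat d))⁻¹) :
    W'⁻¹ = W⁻¹ + η • Lhat + β • (1 : Mat d) := by
  set Z := W⁻¹ + η • Lhat + β • (1 : Mat d)
  have hu : IsUnit Z.det := by
    -- A singular matrix has the default inverse `0`, so positive definiteness of `W'` forces `Z` to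
    -- be invertible.
    by_contra hZ
    have h0 := Matrix.det_nonsing_inv Z
    rw [← h, Ring.inverse_non_unit _ hZ] at h0
    exact hW'.det_pos.ne' h0
  rw [h, Matrix.nonsing_inv_nonsing_inv _ hu]

/-- The last bracket is the divergence from `W` to the unnormalised iterate. After expansion the
claim is exactly `log det (W⁻¹ + η L̂) + log det W' ≤ -β`, which is nonnegativity of the divergence
between `W'` and that iterate. -/
theorem mirror_step {η : ℝ} {U W Lhat W' : Mat d} (hUt : U.trace = 1) (h : IsUpdate η W Lhat W') (hX : (W⁻¹ + η • Lhat).PosDef) :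
    η * ((W - U) * Lhat).trace ≤ potential U W - potential U W'
      + (η * (W * Lhat).trace - Real.log W.det - Real.log (W⁻¹ + η • Lhat).det) := by
  obtain ⟨hW', ht, β, hβ⟩ := h
  have hinv := inv_eq_of_isUpdate hW' hβ
  have hl := log_det_add_log_det_le hX hW'
  have hcancel : W⁻¹ + η • Lhat = W'⁻¹ - β • (1 : Mat d) := by rw [hinv]; simp
  have e1 : ((W⁻¹ + η • Lhat) * W').trace = d - β := by
    rw [hcancel, sub_mul, Matrix.nonsing_inv_mul _ (isUnit_iff_ne_zero.2 hW'.det_pos.ne')]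
    simp [ht]
  have e2 : (W'⁻¹ * U).trace = (W⁻¹ * U).trace + η * (U * Lhat).trace + β := by
    rw [hinv, add_mul, add_mul, Matrix.trace_add, Matrix.trace_add]
    simp [hUt, Matrix.trace_mul_comm Lhat U]
  have e3 : ((W - U) * Lhat).trace = (W * Lhat).trace - (U * Lhat).trace := by
    rw [sub_mul, Matrix.trace_sub]
  unfold potential
  rw [e1] at hl
  rw [e2, e3]
  linarith

theorem posDef_diagonal_add_single {μ : Fin d → ℝ} (hμ : ∀ i, 0 < μ i) (i : Fin d) {a : ℝ}
    (ha : 0 < 1 + a * μ i) :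
    (diagonal (fun k => (μ k)⁻¹) + a • single i i (1 : ℝ)).PosDef ∧
    Real.log (diagonal (fun k => (μ k)⁻¹) + a • single i i (1 : ℝ)).det =
      -(∑ k, Real.log (μ k)) + Real.log (1 + a * μ i) := by
  have e : diagonal (fun k => (μ k)⁻¹) + a • single i i (1 : ℝ) =
      diagonal (fun k => (μ k)⁻¹ * if k = i then 1 + a * μ i else 1) := by
    ext k l
    rcases eq_or_ne k l with rfl | hkl
    · rcases eq_or_ne k i with rfl | hki
      · have := (hμ k).ne'
        simp [field]
      · simp [hki, hki.symm]
    · simp only [Matrix.add_apply, diagonal_apply_ne _ hkl, Matrix.smul_apply, single_apply]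
      rw [if_neg]
      · simp
      · rintro ⟨rfl, rfl⟩; exact hkl rfl
  have hp : ∀ k, 0 < (μ k)⁻¹ * if k = i then 1 + a * μ i else 1 := fun k =>
    mul_pos (inv_pos.2 (hμ k)) (by split_ifs <;> simp [ha])
  rw [e]
  refine ⟨PosDef.diagonal hp, ?_⟩
  rw [det_diagonal, Finset.prod_mul_distrib, Finset.prod_ite_eq' Finset.univ i]
  rw [if_pos (Finset.mem_univ i), Real.log_mul _ ha.ne', Real.log_prod]
  · simp [Finset.sum_neg_distrib]
  · exact fun k _ => (inv_pos.2 (hμ k)).ne'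
  · exact Finset.prod_ne_zero_iff.2 fun k _ => (inv_pos.2 (hμ k)).ne'

/-- Symmetric elimination: a congruence by a transvection, of determinant one, clears the
off-diagonal pair and leaves the Schur complement `1 / μ_i - c² μ_j` at position `(i, i)`. This
reduces to a change of one diagonal entry. -/
theorem posDef_diagonal_add_single_add_single {μ : Fin d → ℝ} (hμ : ∀ i, 0 < μ i) {i j : Fin d}
    (hij : i ≠ j) {c : ℝ} (hc : 0 < 1 - c ^ 2 * (μ i * μ j)) :
    (diagonal (fun k => (μ k)⁻¹) + c • (single i j (1 : ℝ) + single j i 1)).PosDef ∧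
    Real.log (diagonal (fun k => (μ k)⁻¹) + c • (single i j (1 : ℝ) + single j i 1)).det =
      -(∑ k, Real.log (μ k)) + Real.log (1 - c ^ 2 * (μ i * μ j)) := by
  set D := diagonal (fun k => (μ k)⁻¹) + (-(c ^ 2 * μ j)) • single i i (1 : ℝ) with hD
  obtain ⟨hpd, hlog⟩ := posDef_diagonal_add_single hμ i (a := -(c ^ 2 * μ j))
    (by linarith [mul_assoc (c ^ 2) (μ j) (μ i), mul_comm (μ i) (μ j),
      mul_assoc (c ^ 2) (μ i) (μ j), congrArg (c ^ 2 * ·) (mul_comm (μ i) (μ j))])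
  have e : diagonal (fun k => (μ k)⁻¹) + c • (single i j (1 : ℝ) + single j i 1) =
      transvection i j (c * μ j) * D * star (transvection i j (c * μ j)) := by
    have hs : star (transvection i j (c * μ j)) = transvection j i (c * μ j) := by
      simp [transvection, star_eq_conjTranspose]
    have hmj := (hμ j).ne'
    have h1 : ∀ x y : ℝ, single i j x * diagonal (fun k => (μ k)⁻¹) = single i j (x * (μ j)⁻¹) := by
      intro x y
      ext k l
      by_cases hl : j = l <;> simp [mul_diagonal, single_apply, hl]
    have h2 : ∀ x : ℝ, diagonal (fun k => (μ k)⁻¹) * single j i x = single j i ((μ j)⁻¹ * x) := by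
      intro x
      ext k l
      by_cases hl : j = k <;> simp [diagonal_mul, single_apply, hl]
    rw [hs, hD]
    simp only [transvection, add_mul, mul_add, one_mul, mul_one, smul_single, smul_add,
      h1 _ 0, h2, single_mul_single_same, single_mul_single_of_ne _ _ _ _ hij.symm,
      single_mul_single_of_ne _ _ _ _ hij, smul_eq_mul, add_zero]
    have : ∀ x y : ℝ, single i i x + single i i y = single i i (x + y) := fun x y =>
      (single_add i i x y).symm
    have h3 : c * μ j * (μ j)⁻¹ = c := by field_simp
    have h4 : (μ j)⁻¹ * (c * μ j) = c := by field_simp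
    have h5 : c * (c * μ j) = c ^ 2 * μ j := by ring
    rw [h3, h4, h5]
    have h6 : single i i (-(c ^ 2 * μ j)) + single i i (c ^ 2 * μ j) = (0 : Mat d) := by
      rw [this]; simp
    rw [← add_zero (diagonal _ + _), ← h6]
    abel
  have hu : IsUnit (transvection i j (c * μ j)) := by
    rw [Matrix.isUnit_iff_isUnit_det, det_transvection_of_ne _ _ hij]; exact isUnit_one
  rw [e]
  refine ⟨(Matrix.IsUnit.posDef_star_right_conjugate_iff hu).2 hpd, ?_⟩
  rw [det_mul, det_mul, star_eq_conjTranspose, det_conjTranspose, det_transvection_of_ne _ _ hij]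
  simp only [one_mul, star_one, mul_one]
  rw [hlog]
  ring_nf

theorem sub_log_one_add_le {x : ℝ} (hx : -(1 / 2) ≤ x) : x - Real.log (1 + x) ≤ 2 * x ^ 2 := by
  have h1 : 0 < 1 + x := by linarith
  have := Real.one_sub_inv_le_log_of_pos h1
  have h : x - 1 + (1 + x)⁻¹ ≤ 2 * x ^ 2 := by
    have e : x - 1 + (1 + x)⁻¹ = x ^ 2 * (1 + x)⁻¹ := by field_simp; ring
    have h2 : (1 + x)⁻¹ ≤ 2 := inv_le_of_inv_le₀ (by norm_num) (by linarith)
    rw [e, mul_comm 2]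
    exact mul_le_mul_of_nonneg_left h2 (sq_nonneg x)
  linarith

theorem neg_log_one_sub_le {y : ℝ} (hy0 : 0 ≤ y) (hy : y ≤ 1 / 2) :
    -Real.log (1 - y) ≤ 2 * y := by
  have := Real.one_sub_inv_le_log_of_pos (show 0 < 1 - y by linarith)
  have h : (1 - y)⁻¹ ≤ 1 + 2 * y := by
    rw [inv_le_iff_one_le_mul₀ (by linarith)]
    nlinarith
  linarith

end

/-! ### Coordinates in the eigenbasis and the sparse estimate -/

section

variable {d : ℕ}

/-- The orthogonal matrix whose columns are the vectors of the basis `u`. -/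
noncomputable def basisMatrix (u : OrthonormalBasis (Fin d) ℝ (Vec d)) : Mat d := of fun a i => u i a

/-- The matrix of the form `A` in the orthonormal basis `u`. -/
noncomputable def coord (u : OrthonormalBasis (Fin d) ℝ (Vec d)) (A : Mat d) : Mat d :=
  (basisMatrix u)ᵀ * A * basisMatrix u

variable (u : OrthonormalBasis (Fin d) ℝ (Vec d))

theorem basisMatrix_transpose_mul : (basisMatrix u)ᵀ * basisMatrix u = 1 := by
  ext i j
  have := orthonormal_iff_ite.1 u.orthonormal i j
  rw [PiLp.inner_apply] at this
  simpa [Matrix.mul_apply, basisMatrix, one_apply, mul_comm] using this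

theorem basisMatrix_mul_transpose : basisMatrix u * (basisMatrix u)ᵀ = 1 :=
  mul_eq_one_comm.1 (basisMatrix_transpose_mul u)

theorem coord_mul (A B : Mat d) : coord u (A * B) = coord u A * coord u B := by
  have : coord u A * coord u B
      = (basisMatrix u)ᵀ * A * (basisMatrix u * (basisMatrix u)ᵀ) * B * basisMatrix u := by
    simp only [coord, mul_assoc]
  rw [this, basisMatrix_mul_transpose, mul_one, coord, mul_assoc _ A B]

theorem coord_one : coord u (1 : Mat d) = 1 := by
  rw [coord, mul_one, basisMatrix_transpose_mul]

theorem coord_add (A B : Mat d) : coord u (A + B) = coord u A + coord u B := by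
  simp [coord, mul_add, add_mul]

theorem coord_sub (A B : Mat d) : coord u (A - B) = coord u A - coord u B := by
  simp [coord, mul_sub, sub_mul]

theorem coord_smul (c : ℝ) (A : Mat d) : coord u (c • A) = c • coord u A := by
  simp [coord]

theorem coord_sum {ι : Type*} (s : Finset ι) (A : ι → Mat d) :
    coord u (∑ k ∈ s, A k) = ∑ k ∈ s, coord u (A k) := by
  simp [coord, Finset.mul_sum, Finset.sum_mul]

theorem coord_transpose (A : Mat d) : coord u Aᵀ = (coord u A)ᵀ := by
  simp [coord, transpose_mul, mul_assoc]

theorem trace_coord (A : Mat d) : (coord u A).trace = A.trace := by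
  rw [coord, trace_mul_comm, ← mul_assoc, basisMatrix_mul_transpose, one_mul]

theorem det_coord (A : Mat d) : (coord u A).det = A.det := by
  have h := congrArg det (basisMatrix_transpose_mul u)
  rw [det_mul, det_one] at h
  rw [coord, det_mul, det_mul, mul_right_comm, h, one_mul]

theorem isUnit_basisMatrix_transpose : IsUnit (basisMatrix u)ᵀ :=
  ⟨⟨_, _, basisMatrix_transpose_mul u, basisMatrix_mul_transpose u⟩, rfl⟩

theorem posDef_coord_iff {A : Mat d} : (coord u A).PosDef ↔ A.PosDef := by
  have := Matrix.IsUnit.posDef_star_right_conjugate_iff (x := A) (isUnit_basisMatrix_transpose u)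
  rw [star_eq_conjTranspose, conjTranspose_eq_transpose_of_trivial, transpose_transpose] at this
  exact this

theorem coord_apply (A : Mat d) (i j : Fin d) :
    coord u A i j = ∑ b, (∑ a, u i a * A a b) * u j b := by
  simp [coord, Matrix.mul_apply, basisMatrix]

theorem coord_outer (i j : Fin d) : coord u (outer (u i) (u j)) = single i j 1 := by
  have h1 : (basisMatrix u)ᵀ *ᵥ (u i).ofLp = Pi.single i 1 := by
    have := congrArg (fun M : Mat d => M *ᵥ Pi.single i 1) (basisMatrix_transpose_mul u)
    simp only [← mulVec_mulVec, one_mulVec] at this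
    rw [← this]
    congr 1
    ext a
    simp [basisMatrix]
  have h2 : (u j).ofLp ᵥ* basisMatrix u = Pi.single j 1 := by
    have := congrArg (fun M : Mat d => Pi.single j 1 ᵥ* M) (basisMatrix_transpose_mul u)
    simp only [← vecMul_vecMul, vecMul_one] at this
    rw [← this]
    congr 1
    ext a
    simp [basisMatrix]
  rw [coord, outer, mul_vecMulVec, vecMulVec_mul, h1, h2]
  ext k l
  by_cases hi : i = k <;> by_cases hj : j = l <;>
    simp [vecMulVec_apply, single_apply, Pi.single_apply, hi, hj, eq_comm]

theorem frobInner_eq_sum (A B : Mat d) : frobInner A B = ∑ i, ∑ j, A i j * B i j := by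
  rw [frobInner, trace, Finset.sum_comm]
  simp [Matrix.mul_apply]

theorem frobInner_coord (A B : Mat d) : frobInner (coord u A) (coord u B) = frobInner A B := by
  rw [frobInner, ← coord_transpose, ← coord_mul, trace_coord, frobInner]

theorem frobInner_outer (x y : Vec d) (A : Mat d) :
    frobInner (outer x y) A = ∑ a, ∑ b, x a * A a b * y b := by
  rw [frobInner_eq_sum]
  refine Finset.sum_congr rfl fun a _ => Finset.sum_congr rfl fun b _ => ?_
  simp [outer, vecMulVec_apply]; ring

theorem frobInner_outer_basis (A : Mat d) (i j : Fin d) :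
    frobInner (outer (u i) (u j)) A = coord u A i j := by
  rw [← frobInner_coord u, coord_outer, frobInner_eq_sum]
  simp [single_apply, ite_and]

theorem abs_frobInner_outer_le {x y : Vec d} (hx : ‖x‖ = 1) (hy : ‖y‖ = 1) (A : Mat d) :
    |frobInner (outer x y) A| ≤ spectralNorm A := by
  have e : frobInner (outer x y) A
      = inner ℝ x (Matrix.toEuclideanCLM (𝕜 := ℝ) (n := Fin d) A y) := by
    rw [frobInner_outer, PiLp.inner_apply]
    refine Finset.sum_congr rfl fun a _ => ?_
    simp [mulVec, dotProduct, Finset.mul_sum, mul_assoc, mul_comm, mul_left_comm]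
  rw [e]
  refine (abs_real_inner_le_norm _ _).trans ?_
  rw [hx, one_mul]
  refine (ContinuousLinearMap.le_opNorm _ _).trans ?_
  rw [hy, mul_one]
  rfl

theorem abs_coord_le (A : Mat d) (i j : Fin d) : |coord u A i j| ≤ spectralNorm A := by
  rw [← frobInner_outer_basis]
  exact abs_frobInner_outer_le (u.norm_eq_one i) (u.norm_eq_one j) A

theorem frobInner_add_left (A B C : Mat d) :
    frobInner (A + B) C = frobInner A C + frobInner B C := by
  simp [frobInner, add_mul]

theorem frobInner_sub_left (A B C : Mat d) :
    frobInner (A - B) C = frobInner A C - frobInner B C := by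
  simp [frobInner, sub_mul]

theorem frobInner_smul_left (c : ℝ) (A C : Mat d) :
    frobInner (c • A) C = c * frobInner A C := by
  simp [frobInner]

theorem frobNorm_sq (A : Mat d) : frobNorm A ^ 2 = frobInner A A := by
  rw [frobNorm, Real.sq_sqrt]
  rw [frobInner_eq_sum]
  exact Finset.sum_nonneg fun i _ => Finset.sum_nonneg fun j _ => mul_self_nonneg _

/-- The loss of the sparse action, in terms of the loss matrix `K` in the basis. -/
noncomputable def sparseLoss (K : Mat d) (i j : Fin d) (s : ℝ) : ℝ :=
  if i = j then K i i else (K i i + K j j + 2 * s * K i j) / 2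

theorem frobInner_sparseAction {A : Mat d} (hA : A.IsSymm) (i j : Fin d) {s : ℝ}
    (hs : s = -1 ∨ s = 1) :
    frobInner (outer (sparseAction u i j s) (sparseAction u i j s)) A
      = sparseLoss (coord u A) i j s := by
  have hs2 : s * s = 1 := by rcases hs with rfl | rfl <;> norm_num
  rw [sparseAction, sparseLoss]
  split_ifs with h
  · rw [frobInner_outer_basis]
  · have e : outer ((1 / Real.sqrt 2) • (u i + s • u j)) ((1 / Real.sqrt 2) • (u i + s • u j))
        = (1 / 2 : ℝ) • (outer (u i) (u i) + s • outer (u i) (u j) + s • outer (u j) (u i)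
          + outer (u j) (u j)) := by
      ext a b
      have h2 : (√2)⁻¹ * (√2)⁻¹ = (1 / 2 : ℝ) := by
        rw [← mul_inv, Real.mul_self_sqrt (by norm_num)]; norm_num
      simp only [outer, vecMulVec_apply, one_div, PiLp.smul_apply, PiLp.add_apply, smul_eq_mul,
        Matrix.add_apply, Matrix.smul_apply]
      linear_combination ((u i a + s * u j a) * (u i b + s * u j b)) * h2
        + 1 / 2 * u j a * u j b * hs2
    have hsym : coord u A j i = coord u A i j := by
      have := coord_transpose u A
      rw [hA.eq] at this
      exact congrFun (congrFun this j) i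
    rw [e, frobInner_smul_left, frobInner_add_left, frobInner_add_left, frobInner_add_left,
      frobInner_smul_left, frobInner_smul_left]
    simp only [frobInner_outer_basis, hsym]
    ring

/-- The coefficient of the loss estimate. -/
noncomputable def estimateCoeff (lam : Fin d → ℝ) (K : Mat d) (i j : Fin d) (s : ℝ) : ℝ :=
  (if i = j then 1 else s) * sparseLoss K i j s / (lam i * lam j)

/-- Both cases of the estimate take one form: for `i = j` the two matrix units coincide, which
absorbs the factor `1 / 2`. -/
theorem coord_sparseEstimate (lam : Fin d → ℝ) (K : Mat d) (i j : Fin d) (s : ℝ) :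
    coord u (sparseEstimate u lam i j s (sparseLoss K i j s)) =
      (estimateCoeff lam K i j s / 2) • (single i j 1 + single j i 1) := by
  rw [sparseEstimate, estimateCoeff]
  split_ifs with h
  · subst h
    rw [coord_smul, coord_outer, ← two_smul ℝ (single i i (1 : ℝ)), smul_smul]
    congr 1
    ring
  · rw [coord_smul, coord_add, coord_outer, coord_outer]
    congr 1
    ring

theorem trace_mul_sparseEstimate {X : Mat d} (hX : X.IsSymm) (lam : Fin d → ℝ) (K : Mat d)
    (i j : Fin d) (s : ℝ) :
    (X * sparseEstimate u lam i j s (sparseLoss K i j s)).trace =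
      estimateCoeff lam K i j s * coord u X i j := by
  have hsym : coord u X j i = coord u X i j := by
    have := coord_transpose u X
    rw [hX.eq] at this
    exact congrFun (congrFun this j) i
  rw [← trace_coord u, coord_mul, coord_sparseEstimate, mul_smul_comm, trace_smul, mul_add,
    trace_add, trace_mul_single, trace_mul_single, hsym]
  simp
  ring

variable {u} in
theorem coord_of_eigen {W : Mat d} {μ : Fin d → ℝ} (h : W = ∑ i, μ i • outer (u i) (u i)) :
    coord u W = diagonal μ := by
  rw [h, coord_sum]
  simp only [coord_smul, coord_outer, smul_single, smul_eq_mul, mul_one]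
  exact sum_single_eq_diagonal μ

variable {u} in
theorem coord_inv_of_eigen {W : Mat d} {μ : Fin d → ℝ} (hW : W.PosDef)
    (h : coord u W = diagonal μ) (hμ : ∀ i, 0 < μ i) :
    coord u W⁻¹ = diagonal fun i => (μ i)⁻¹ := by
  have h1 : coord u W * coord u W⁻¹ = 1 := by
    rw [← coord_mul, mul_nonsing_inv _ (isUnit_iff_ne_zero.2 hW.det_pos.ne'), coord_one]
  have h2 : (diagonal fun i => (μ i)⁻¹) * coord u W = 1 := by
    rw [h, diagonal_mul_diagonal, ← diagonal_one]
    congr 1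
    funext i
    exact inv_mul_cancel₀ (hμ i).ne'
  exact (left_inv_eq_right_inv h2 h1).symm

/-- Entrywise bounds alone give `(1 + 1 + 2) / 2 = 2`; this is crude but suffices for stability and
integrability. -/
theorem abs_sparseLoss_le {K : Mat d} (hK : ∀ i j, |K i j| ≤ 1) (i j : Fin d) {s : ℝ}
    (hs : s = -1 ∨ s = 1) : |sparseLoss K i j s| ≤ 2 := by
  have h1 := abs_le.1 (hK i i)
  have h2 := abs_le.1 (hK j j)
  have h3 := abs_le.1 (hK i j)
  rw [sparseLoss, abs_le]
  rcases hs with rfl | rfl <;> split_ifs <;> constructor <;> linarith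

variable {u} in
/-- The update direction keeps the inverse density matrix positive definite, and the local
divergence is at most quadratic in the estimate. -/
theorem posDef_and_divergence_le {η : ℝ} (hη : 0 < η) {W : Mat d} {μ lam : Fin d → ℝ}
    (hW : W.PosDef) (hWu : coord u W = diagonal μ) (hμ : ∀ i, 0 < μ i) (hlam : ∀ i, 0 < lam i)
    (hstab : ∀ i, 2 * (η * μ i) ≤ lam i ^ 2) {K : Mat d} (hK : ∀ i j, |K i j| ≤ 1) (i j : Fin d)
    {s : ℝ} (hs : s = -1 ∨ s = 1) :
    (W⁻¹ + η • sparseEstimate u lam i j s (sparseLoss K i j s)).PosDef ∧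
    η * (W * sparseEstimate u lam i j s (sparseLoss K i j s)).trace - Real.log W.det
        - Real.log (W⁻¹ + η • sparseEstimate u lam i j s (sparseLoss K i j s)).det
      ≤ η ^ 2 * (2 * (μ i * μ j) * estimateCoeff lam K i j s ^ 2) := by
  have hWs : W.IsSymm := by
    have := hW.isHermitian.eq
    rwa [conjTranspose_eq_transpose_of_trivial] at this
  have hdet : Real.log W.det = ∑ k, Real.log (μ k) := by
    rw [← det_coord u, hWu, det_diagonal, Real.log_prod fun k _ => (hμ k).ne']
  have hc : coord u (W⁻¹ + η • sparseEstimate u lam i j s (sparseLoss K i j s)) =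
      diagonal (fun k => (μ k)⁻¹)
        + (η * (estimateCoeff lam K i j s / 2)) • (single i j (1 : ℝ) + single j i 1) := by
    rw [coord_add, coord_inv_of_eigen hW hWu hμ, coord_smul, coord_sparseEstimate, smul_smul]
  rw [trace_mul_sparseEstimate u hWs, ← posDef_coord_iff u,
    ← det_coord u (W⁻¹ + η • sparseEstimate u lam i j s (sparseLoss K i j s)), hc, hWu, hdet]
  set e := estimateCoeff lam K i j s with he
  rcases eq_or_ne i j with rfl | hij
  · have hsm : (η * (e / 2)) • (single i i (1 : ℝ) + single i i 1) = (η * e) • single i i 1 := by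
      rw [← two_smul ℝ (single i i (1 : ℝ)), smul_smul]
      congr 1; ring
    have hx : |η * e * μ i| ≤ 1 / 2 := by
      have : η * e * μ i = (η * μ i / lam i ^ 2) * K i i := by
        rw [he, estimateCoeff, sparseLoss]
        simp; ring
      rw [this, abs_mul, abs_of_nonneg (by have := hμ i; positivity)]
      have h1 : η * μ i / lam i ^ 2 ≤ 1 / 2 := by
        rw [div_le_iff₀ (pow_pos (hlam i) 2)]; linarith [hstab i]
      calc _ ≤ (1 / 2 : ℝ) * 1 := mul_le_mul h1 (hK i i) (abs_nonneg _) (by norm_num)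
        _ = _ := by norm_num
    have hx' := (abs_le.1 hx).1
    obtain ⟨hp, hl⟩ := posDef_diagonal_add_single hμ i (a := η * e) (by linarith)
    rw [hsm]
    refine ⟨hp, ?_⟩
    rw [hl, diagonal_apply_eq]
    have := sub_log_one_add_le hx'
    nlinarith [this]
  · set y := (η * (e / 2)) ^ 2 * (μ i * μ j) with hy
    have hy0 : 0 ≤ y := mul_nonneg (sq_nonneg _) (mul_pos (hμ i) (hμ j)).le
    have hy1 : y ≤ 1 / 2 := by
      have hl := abs_le.1 (abs_sparseLoss_le hK i j hs)
      have hl2 : sparseLoss K i j s ^ 2 ≤ 4 := by nlinarith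
      have hs2 : s ^ 2 = 1 := by rcases hs with rfl | rfl <;> norm_num
      -- Splitting `y` this way lets the stability condition bound each of the first two factors by
      -- `1 / 2`; the last is at most `1`.
      have : y = (η * μ i / lam i ^ 2) * (η * μ j / lam j ^ 2) * (sparseLoss K i j s ^ 2 / 4) := by
        have h1 := (hlam i).ne'
        have h2 := (hlam j).ne'
        rw [hy, he, estimateCoeff, if_neg hij]
        field_simp
        rw [hs2]; ring
      have hb : ∀ k, 0 ≤ η * μ k / lam k ^ 2 ∧ η * μ k / lam k ^ 2 ≤ 1 / 2 := fun k => by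
        refine ⟨by have := hμ k; positivity, ?_⟩
        rw [div_le_iff₀ (pow_pos (hlam k) 2)]; linarith [hstab k]
      rw [this]
      calc _ ≤ (1 / 2 : ℝ) * (1 / 2) * 1 := by
            refine mul_le_mul (mul_le_mul (hb i).2 (hb j).2 (hb j).1 (by norm_num)) (by linarith)
              (by positivity) (by norm_num)
        _ ≤ _ := by norm_num
    obtain ⟨hp, hl⟩ := posDef_diagonal_add_single_add_single hμ hij (c := η * (e / 2))
      (by linarith)
    refine ⟨hp, ?_⟩
    rw [hl, diagonal_apply_ne _ hij]
    have := neg_log_one_sub_le hy0 hy1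
    rw [← hy]
    -- Here the trace term vanishes and `2 y` would do; the slack gives both cases the same
    -- quadratic bound.
    have hz : η ^ 2 * (2 * (μ i * μ j) * e ^ 2) = 8 * y := by rw [hy]; ring
    rw [hz]
    linarith

end

/-! ### Averaging over the draws of one round -/

section
variable {Ω : Type*} {mΩ : MeasurableSpace Ω} {d : ℕ} {P : Measure Ω} [IsProbabilityMeasure P]
  {ℱ : Filtration ℕ mΩ} {T : ℕ} {η γ : ℝ} {L : ℕ → Ω → Mat d}

/-- Pull-out of a bounded function of the past against the indicator of an event. -/
theorem integral_indicator_mul_of_condExp {m : MeasurableSpace Ω} (hm : m ≤ mΩ) {A : Set Ω}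
    (hA : MeasurableSet[mΩ] A) {p g : Ω → ℝ}
    (hp : P[A.indicator (fun _ => (1 : ℝ)) | m] =ᵐ[P] p)
    (hg : Measurable[m] g) {C : ℝ} (hC : ∀ ω, |g ω| ≤ C) :
    Integrable (fun ω => g ω * A.indicator (fun _ => (1 : ℝ)) ω) P ∧
    Integrable (fun ω => g ω * p ω) P ∧
    ∫ ω, g ω * A.indicator (fun _ => (1 : ℝ)) ω ∂P = ∫ ω, g ω * p ω ∂P := by
  have hind : Integrable (A.indicator (fun _ => (1 : ℝ))) P :=
    (integrable_const (1 : ℝ)).indicator hA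
  have hgs : StronglyMeasurable[m] g := hg.stronglyMeasurable
  have hint : Integrable (g * A.indicator (fun _ => (1 : ℝ))) P :=
    hind.bdd_mul (hgs.mono hm).aestronglyMeasurable (c := C) (ae_of_all _ hC)
  have hce : P[g * A.indicator (fun _ => (1 : ℝ)) | m] =ᵐ[P] fun ω => g ω * p ω := by
    refine (condExp_mul_of_stronglyMeasurable_left hgs hint hind).trans ?_
    filter_upwards [hp] with ω hω
    simp [hω]
  refine ⟨hint, integrable_condExp.congr hce, ?_⟩
  rw [← integral_congr_ae hce, integral_condExp hm]
  rfl

/-- The expectation of a bounded function of the past and the draws of round `t`. -/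
theorem SparseRun.integral_draw (R : SparseRun P ℱ T η γ L) {t : ℕ} (ht : t ∈ Finset.Icc 1 T)
    (F : Fin d → Fin d → ℝ → Ω → ℝ) (hF : ∀ i j s, s = -1 ∨ s = 1 → Measurable[ℱ t] (F i j s))
    {C : ℝ} (hC : ∀ i j s, s = -1 ∨ s = 1 → ∀ ω, |F i j s ω| ≤ C) :
    Integrable (fun ω => F (R.I t ω) (R.J t ω) (R.s t ω) ω) P ∧
    Integrable (fun ω => ∑ i, ∑ j, mixWeights γ (R.μ t ω) i * mixWeights γ (R.μ t ω) j
      * ((F i j (-1) ω + F i j 1 ω) / 2)) P ∧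
    ∫ ω, F (R.I t ω) (R.J t ω) (R.s t ω) ω ∂P =
      ∫ ω, ∑ i, ∑ j, mixWeights γ (R.μ t ω) i * mixWeights γ (R.μ t ω) j
      * ((F i j (-1) ω + F i j 1 ω) / 2) ∂P := by
  let A : Fin d → Fin d → ℝ → Set Ω := fun i j σ => {ω | R.I t ω = i ∧ R.J t ω = j ∧ R.s t ω = σ}
  let p : Fin d → Fin d → Ω → ℝ := fun i j ω =>
    mixWeights γ (R.μ t ω) i * mixWeights γ (R.μ t ω) j * (1 / 2)
  have hA : ∀ i j σ, MeasurableSet (A i j σ) := fun i j σ => by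
    have h1 := ((R.measurable_I t ht).mono (ℱ.le _) le_rfl) (measurableSet_singleton i)
    have h2 := ((R.measurable_J t ht).mono (ℱ.le _) le_rfl) (measurableSet_singleton j)
    have h3 := ((R.measurable_s t ht).mono (ℱ.le _) le_rfl) (measurableSet_singleton σ)
    exact h1.inter (h2.inter h3)
  have key : ∀ i j (σ : ℝ), σ = -1 ∨ σ = 1 → _ := fun i j σ hσ =>
    integral_indicator_mul_of_condExp (ℱ.le t) (hA i j σ) (R.draw t ht i j σ hσ) (hF i j σ hσ)
      (hC i j σ hσ)
  -- Exactly one of the events `A i j σ` with `σ = ±1` occurs, so the integrand is a finite sum of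
  -- functions of the past times indicators, to which the pull-out property applies.
  have e1 : (fun ω => F (R.I t ω) (R.J t ω) (R.s t ω) ω) = fun ω => ∑ i, ∑ j,
      (F i j (-1) ω * (A i j (-1)).indicator (fun _ => (1 : ℝ)) ω
        + F i j 1 ω * (A i j 1).indicator (fun _ => (1 : ℝ)) ω) := by
    funext ω
    rw [Finset.sum_eq_single (R.I t ω), Finset.sum_eq_single (R.J t ω)]
    · rcases R.sign t ht ω with h | h
      · simp [A, Set.indicator_apply, h]; norm_num
      · simp [A, Set.indicator_apply, h]; norm_num
    · intro j _ hj
      simp [A, hj.symm]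
    · simp
    · intro i _ hi
      simp [A, hi.symm]
    · simp
  have e2 : (fun ω => ∑ i, ∑ j, mixWeights γ (R.μ t ω) i * mixWeights γ (R.μ t ω) j
      * ((F i j (-1) ω + F i j 1 ω) / 2)) = fun ω => ∑ i, ∑ j,
      (F i j (-1) ω * p i j ω + F i j 1 ω * p i j ω) := by
    funext ω
    refine Finset.sum_congr rfl fun i _ => Finset.sum_congr rfl fun j _ => ?_
    simp only [p]; ring
  have k1 := fun i j => key i j (-1) (Or.inl rfl)
  have k2 := fun i j => key i j 1 (Or.inr rfl)
  rw [e1, e2]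
  have k3 : ∀ i j, Integrable (fun ω => F i j (-1) ω * (A i j (-1)).indicator (fun _ => (1 : ℝ)) ω
      + F i j 1 ω * (A i j 1).indicator (fun _ => (1 : ℝ)) ω) P := fun i j =>
    (k1 i j).1.add (k2 i j).1
  have k4 : ∀ i j, Integrable (fun ω => F i j (-1) ω * p i j ω + F i j 1 ω * p i j ω) P :=
    fun i j => (k1 i j).2.1.add (k2 i j).2.1
  have k5 := fun i => integrable_finsetSum Finset.univ fun j _ => k3 i j
  have k6 := fun i => integrable_finsetSum Finset.univ fun j _ => k4 i j
  refine ⟨integrable_finsetSum _ fun i _ => k5 i, integrable_finsetSum _ fun i _ => k6 i, ?_⟩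
  rw [integral_finsetSum _ fun i _ => k5 i, integral_finsetSum _ fun i _ => k6 i]
  refine Finset.sum_congr rfl fun i _ => ?_
  rw [integral_finsetSum _ fun j _ => k3 i j, integral_finsetSum _ fun j _ => k4 i j]
  refine Finset.sum_congr rfl fun j _ => ?_
  rw [integral_add (k1 i j).1 (k2 i j).1, integral_add (k1 i j).2.1 (k2 i j).2.1,
    (k1 i j).2.2, (k2 i j).2.2]

end

/-! ### First and second moments of the loss and its estimate -/

section
variable {d : ℕ} {K : Mat d}

/-- The sign averages out the cross term, so in mean the sparse action costs the same as a single
eigenvector drawn from `lam`. -/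
theorem mean_sparseLoss {lam : Fin d → ℝ} (hlam : ∑ i, lam i = 1) :
    ∑ i, ∑ j, lam i * lam j * ((sparseLoss K i j (-1) + sparseLoss K i j 1) / 2)
      = ∑ i, lam i * K i i := by
  have h : ∀ i j, lam i * lam j * ((sparseLoss K i j (-1) + sparseLoss K i j 1) / 2)
      = lam i * K i i / 2 * lam j + lam i * (lam j * K j j / 2) := fun i j => by
    unfold sparseLoss
    split_ifs with h
    · subst h; ring
    · ring
  simp only [h, Finset.sum_add_distrib, ← Finset.mul_sum, ← Finset.sum_mul, hlam]
  rw [← Finset.sum_div]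
  ring

/-- Unbiasedness: the importance weights cancel the probabilities, and for `i ≠ j` averaging the
loss against the sign isolates `K i j`. -/
theorem mean_estimateCoeff_mul {lam : Fin d → ℝ} (hlam : ∀ i, 0 < lam i) (X : Mat d) :
    ∑ i, ∑ j, lam i * lam j * ((estimateCoeff lam K i j (-1) * X i j
      + estimateCoeff lam K i j 1 * X i j) / 2) = frobInner X K := by
  rw [frobInner_eq_sum]
  refine Finset.sum_congr rfl fun i _ => Finset.sum_congr rfl fun j _ => ?_
  have h1 := (hlam i).ne'
  have h2 := (hlam j).ne'
  unfold estimateCoeff sparseLoss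
  split_ifs with h
  · subst h
    field_simp
    ring
  · field_simp
    ring

/-- One factor `lam i * lam j` cancels, and the ratios `μ / lam` are at most `2`. Diagonal entries
of `K` then gain a factor `d` from the free index, while each off-diagonal entry counts once; `d ≥
1` merges the two into the Frobenius norm. -/
theorem mean_quadratic_le {lam μ : Fin d → ℝ} (hlam : ∀ i, 0 < lam i) (hμ : ∀ i, 0 ≤ μ i)
    (hμlam : ∀ i, μ i ≤ 2 * lam i) :
    ∑ i, ∑ j, lam i * lam j * ((2 * (μ i * μ j) * estimateCoeff lam K i j (-1) ^ 2
      + 2 * (μ i * μ j) * estimateCoeff lam K i j 1 ^ 2) / 2) ≤ 8 * d * frobInner K K := by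
  have h : ∀ i j, lam i * lam j * ((2 * (μ i * μ j) * estimateCoeff lam K i j (-1) ^ 2
      + 2 * (μ i * μ j) * estimateCoeff lam K i j 1 ^ 2) / 2)
      ≤ 4 * K i i ^ 2 + 4 * K j j ^ 2 + 8 * (if i = j then 0 else K i j ^ 2) := fun i j => by
    have e : lam i * lam j * ((2 * (μ i * μ j) * estimateCoeff lam K i j (-1) ^ 2
        + 2 * (μ i * μ j) * estimateCoeff lam K i j 1 ^ 2) / 2) =
        (μ i / lam i) * (μ j / lam j) * (sparseLoss K i j (-1) ^ 2 + sparseLoss K i j 1 ^ 2) := by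
      have h1 := (hlam i).ne'
      have h2 := (hlam j).ne'
      unfold estimateCoeff
      split_ifs <;> field_simp
    have hb : ∀ k, 0 ≤ μ k / lam k ∧ μ k / lam k ≤ 2 := fun k =>
      ⟨div_nonneg (hμ k) (hlam k).le, (div_le_iff₀ (hlam k)).2 (hμlam k)⟩
    rw [e]
    calc _ ≤ 2 * 2 * (sparseLoss K i j (-1) ^ 2 + sparseLoss K i j 1 ^ 2) := by
          refine mul_le_mul_of_nonneg_right (mul_le_mul (hb i).2 (hb j).2 (hb j).1 (by norm_num))
            (by positivity)
      _ ≤ _ := by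
          unfold sparseLoss
          split_ifs with hij
          · subst hij; linarith
          · nlinarith [sq_nonneg (K i i - K j j)]
  refine (Finset.sum_le_sum fun i _ => Finset.sum_le_sum fun j _ => h i j).trans ?_
  rw [frobInner_eq_sum]
  simp only [Finset.sum_add_distrib, Finset.sum_const, Finset.card_univ, Fintype.card_fin,
    nsmul_eq_mul, ← Finset.mul_sum]
  have e : ∑ i, ∑ j, K i j * K i j
      = ∑ i, K i i ^ 2 + ∑ i, ∑ j, if i = j then 0 else K i j ^ 2 := by
    rw [← Finset.sum_add_distrib]
    refine Finset.sum_congr rfl fun i _ => ?_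
    rw [← Finset.sum_erase_add _ _ (Finset.mem_univ i),
      ← Finset.sum_erase_add Finset.univ (fun j => if i = j then 0 else K i j ^ 2)
        (Finset.mem_univ i)]
    simp only [if_true, add_zero]
    rw [add_comm]
    congr 1
    · ring
    · refine Finset.sum_congr rfl fun j hj => ?_
      rw [if_neg (Finset.ne_of_mem_erase hj).symm]; ring
  rw [e]
  set S := ∑ i, ∑ j, if i = j then 0 else K i j ^ 2
  have hS : 0 ≤ S := Finset.sum_nonneg fun i _ => Finset.sum_nonneg fun j _ => by
    split_ifs <;> positivity
  rcases Nat.eq_zero_or_pos d with rfl | hd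
  · simp [S]
  · have hd1 : (1 : ℝ) ≤ d := by exact_mod_cast hd
    nlinarith [mul_le_mul_of_nonneg_right hd1 hS]

end

/-! ### The smoothed comparator -/

section
variable {d : ℕ}

/-- The comparator `(1 - θ) v vᵀ + (θ / d) I`. -/
noncomputable def comparator (θ : ℝ) (v : Vec d) : Mat d :=
  (1 - θ) • outer v v + (θ / d) • (1 : Mat d)

theorem outer_posSemidef (v : Vec d) : (outer v v).PosSemidef := by
  simpa [outer] using posSemidef_vecMulVec_self_star v.ofLp

theorem trace_outer {v : Vec d} (hv : ‖v‖ = 1) : (outer v v).trace = 1 := by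
  have : ‖v‖ ^ 2 = 1 := by rw [hv]; norm_num
  rw [EuclideanSpace.norm_sq_eq] at this
  simpa [outer, trace, vecMulVec_apply, pow_two] using this

theorem comparator_posDef (hd : 0 < d) {θ : ℝ} (hθ : 0 < θ) (hθ1 : θ ≤ 1) (v : Vec d) :
    (comparator θ v).PosDef := by
  have hd' : (0 : ℝ) < d := by exact_mod_cast hd
  exact PosDef.posSemidef_add ((outer_posSemidef v).smul (by linarith))
    (PosDef.one.smul (div_pos hθ hd'))

theorem comparator_trace (hd : 0 < d) (θ : ℝ) {v : Vec d} (hv : ‖v‖ = 1) :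
    (comparator θ v).trace = 1 := by
  have hd' : (d : ℝ) ≠ 0 := by exact_mod_cast hd.ne'
  rw [comparator, trace_add, trace_smul, trace_smul, trace_outer hv, trace_one]
  simp [hd']

theorem comparator_isSymm (θ : ℝ) (v : Vec d) : (comparator θ v).IsSymm := by
  ext i j
  simp only [comparator, outer, transpose_apply, Matrix.add_apply, Matrix.smul_apply,
    vecMulVec_apply, one_apply, smul_eq_mul, eq_comm (a := j) (b := i)]
  ring

/-- The comparator is a nonnegative rank-one update of `(θ / d) I`, so the matrix determinant lemma
shows that its determinant is no smaller. -/
theorem log_det_comparator_ge (hd : 0 < d) {θ : ℝ} (hθ : 0 < θ) (hθ1 : θ ≤ 1) {v : Vec d}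
    (hv : ‖v‖ = 1) : d * Real.log (θ / d) ≤ Real.log (comparator θ v).det := by
  have hd' : (0 : ℝ) < d := by exact_mod_cast hd
  have hpos : 0 < θ / d := div_pos hθ hd'
  have e : comparator θ v = (θ / d) • (1 + vecMulVec (((1 - θ) / (θ / d)) • v.ofLp) v.ofLp) := by
    rw [comparator, smul_add, add_comm, smul_vecMulVec, smul_smul, mul_div_cancel₀ _ hpos.ne', outer]
  have hvv : v.ofLp ⬝ᵥ v.ofLp = 1 := by
    have := trace_outer hv
    rwa [outer, trace_vecMulVec] at this
  rw [e, det_smul, vecMulVec_eq Unit, det_one_add_replicateCol_mul_replicateRow, dotProduct_smul,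
    hvv, Fintype.card_fin, ← Real.log_pow]
  refine Real.log_le_log (by positivity) ?_
  refine le_mul_of_one_le_right (by positivity) ?_
  have : 0 ≤ (1 - θ) / (θ / d) := div_nonneg (by linarith) hpos.le
  simpa using this

theorem potential_ge {U W : Mat d} (hU : U.PosDef) (hW : W.PosDef) :
    d + Real.log U.det ≤ potential U W := by
  have h := log_det_add_log_det_le hU hW.inv
  rw [det_nonsing_inv, Ring.inverse_eq_inv', Real.log_inv, trace_mul_comm] at h
  unfold potential
  linarith

theorem potential_init (hd : 0 < d) {U : Mat d} (hU : U.trace = 1) :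
    potential U ((1 / (d : ℝ)) • (1 : Mat d)) = d - d * Real.log d := by
  have hd' : (d : ℝ) ≠ 0 := by exact_mod_cast hd.ne'
  have : ((1 / (d : ℝ)) • (1 : Mat d))⁻¹ = (d : ℝ) • 1 := by
    refine inv_eq_left_inv ?_
    simp [smul_smul, hd']
  rw [potential, this, det_smul, det_one, Fintype.card_fin, mul_one, Real.log_pow]
  simp [hU, Real.log_inv]
  ring

theorem potential_sub_le (hd : 0 < d) {θ : ℝ} (hθ : 0 < θ) (hθ1 : θ ≤ 1) {v : Vec d}
    (hv : ‖v‖ = 1) {W : Mat d} (hW : W.PosDef) :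
    potential (comparator θ v) ((1 / (d : ℝ)) • (1 : Mat d)) - potential (comparator θ v) W
      ≤ -(d * Real.log θ) := by
  have hd' : (0 : ℝ) < d := by exact_mod_cast hd
  have h1 := potential_init hd (comparator_trace hd θ hv)
  have h2 := potential_ge (comparator_posDef hd hθ hθ1 v) hW
  have h3 := log_det_comparator_ge hd hθ hθ1 hv
  rw [Real.log_div hθ.ne' hd'.ne'] at h3
  linarith

/-- Price of exploration and smoothing: each moves a share, `γ` or `θ`, of a density matrix to or
from `I / d`. All losses involved lie in `[-1, 1]`, so each costs at most twice its share. -/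
theorem comparator_loss_le (hd : 0 < d) {θ γ η : ℝ} (hθ : 0 ≤ θ) (hη : 0 ≤ η) (hγ : γ = η * d)
    {v : Vec d} (hv : ‖v‖ = 1) {A W : Mat d} (hA : spectralNorm A ≤ 1)
    (u : OrthonormalBasis (Fin d) ℝ (Vec d)) {μ : Fin d → ℝ} (hW : coord u W = diagonal μ)
    (hμ : ∀ i, 0 ≤ μ i) (hμ1 : ∑ i, μ i = 1) :
    ∑ i, mixWeights γ μ i * coord u A i i - frobInner (outer v v) A
      ≤ frobInner (W - comparator θ v) A + 2 * γ + 2 * θ := by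
  have hd' : (0 : ℝ) < d := by exact_mod_cast hd
  have hK : ∀ i, |coord u A i i| ≤ 1 := fun i => (abs_coord_le u A i i).trans hA
  have hv1 := abs_le.1 ((abs_frobInner_outer_le hv hv A).trans hA)
  have hWA : frobInner W A = ∑ i, μ i * coord u A i i := by
    rw [← frobInner_coord u, hW, frobInner_eq_sum]
    simp [diagonal_apply]
  have htr : frobInner 1 A = ∑ i, coord u A i i := by
    rw [← frobInner_coord u, coord_one, frobInner_eq_sum]
    simp [one_apply]
  have h1 : |∑ i, μ i * coord u A i i| ≤ 1 := by
    refine (Finset.abs_sum_le_sum_abs _ _).trans ?_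
    rw [← hμ1]
    refine Finset.sum_le_sum fun i _ => ?_
    rw [abs_mul, abs_of_nonneg (hμ i)]
    exact mul_le_of_le_one_right (hμ i) (hK i)
  have h2 : ∑ i, coord u A i i ≤ d := by
    refine (Finset.sum_le_sum fun i _ => (le_abs_self _).trans (hK i)).trans ?_
    simp
  have hmix : ∑ i, mixWeights γ μ i * coord u A i i
      = (1 - γ) * ∑ i, μ i * coord u A i i + η * ∑ i, coord u A i i := by
    rw [Finset.mul_sum, Finset.mul_sum, ← Finset.sum_add_distrib]
    refine Finset.sum_congr rfl fun i _ => ?_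
    rw [mixWeights, hγ]
    field_simp
  rw [hmix, frobInner_sub_left, comparator, frobInner_add_left, frobInner_smul_left,
    frobInner_smul_left, hWA, htr]
  have h1' := abs_le.1 h1
  have hγ0 : 0 ≤ γ := by rw [hγ]; positivity
  have a1 : η * ∑ i, coord u A i i ≤ γ := by
    rw [hγ]; exact mul_le_mul_of_nonneg_left h2 hη
  have a2 : θ / d * ∑ i, coord u A i i ≤ θ := by
    calc _ ≤ θ / d * d := mul_le_mul_of_nonneg_left h2 (by positivity)
      _ = θ := by field_simp
  nlinarith [mul_nonneg hγ0 (by linarith [h1'.1] : 0 ≤ 1 + ∑ i, μ i * coord u A i i),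
    mul_nonneg hθ (by linarith [hv1.1] : 0 ≤ 1 + frobInner (outer v v) A)]

end

/-! ### Invariants of a run, weights and measurability -/

section
variable {Ω : Type*} {mΩ : MeasurableSpace Ω} {d : ℕ} {P : Measure Ω}
  {ℱ : Filtration ℕ mΩ} {T : ℕ} {η γ : ℝ} {L : ℕ → Ω → Mat d}

namespace SparseRun

/-- The shifted index reaches `W (T + 1)`, where the telescoping sum of potentials ends. -/
theorem posDef_and_trace (hd : 0 < d) (R : SparseRun P ℱ T η γ L) (ω : Ω) :
    ∀ t, t ≤ T → (R.W (t + 1) ω).PosDef ∧ (R.W (t + 1) ω).trace = 1 := by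
  have hd' : (0 : ℝ) < d := by exact_mod_cast hd
  intro t
  rcases t with _ | t
  · intro _
    rw [R.init ω]
    exact ⟨PosDef.one.smul (by positivity), by simp [hd'.ne']⟩
  · intro h
    have := R.update (t + 1) (Finset.mem_Icc.2 ⟨by omega, h⟩) ω
    exact ⟨this.1, this.2.1⟩

theorem posDef (hd : 0 < d) (R : SparseRun P ℱ T η γ L) {t : ℕ} (ht : t ∈ Finset.Icc 1 T) (ω : Ω) :
    (R.W t ω).PosDef := by
  obtain ⟨h1, h2⟩ := Finset.mem_Icc.1 ht
  obtain ⟨t, rfl⟩ := Nat.exists_eq_add_of_le' h1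
  exact (R.posDef_and_trace hd ω t (by omega)).1

theorem trace (hd : 0 < d) (R : SparseRun P ℱ T η γ L) {t : ℕ} (ht : t ∈ Finset.Icc 1 T) (ω : Ω) :
    (R.W t ω).trace = 1 := by
  obtain ⟨h1, h2⟩ := Finset.mem_Icc.1 ht
  obtain ⟨t, rfl⟩ := Nat.exists_eq_add_of_le' h1
  exact (R.posDef_and_trace hd ω t (by omega)).2

theorem coord_W (R : SparseRun P ℱ T η γ L) {t : ℕ} (ht : t ∈ Finset.Icc 1 T) (ω : Ω) :
    coord (R.u t ω) (R.W t ω) = diagonal (R.μ t ω) :=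
  coord_of_eigen (R.eigen t ht ω)

theorem μ_pos (hd : 0 < d) (R : SparseRun P ℱ T η γ L) {t : ℕ} (ht : t ∈ Finset.Icc 1 T) (ω : Ω)
    (i : Fin d) : 0 < R.μ t ω i := by
  have h := (posDef_coord_iff (R.u t ω)).2 (R.posDef hd ht ω)
  rw [R.coord_W ht] at h
  exact posDef_diagonal_iff.1 h i

theorem sum_μ (hd : 0 < d) (R : SparseRun P ℱ T η γ L) {t : ℕ} (ht : t ∈ Finset.Icc 1 T) (ω : Ω) :
    ∑ i, R.μ t ω i = 1 := by
  rw [← R.trace hd ht ω, ← trace_coord (R.u t ω), R.coord_W ht, trace_diagonal]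

end SparseRun

theorem sum_mixWeights (hd : 0 < d) (γ : ℝ) {μ : Fin d → ℝ} (hμ : ∑ i, μ i = 1) :
    ∑ i, mixWeights γ μ i = 1 := by
  have hd' : (d : ℝ) ≠ 0 := by exact_mod_cast hd.ne'
  simp [mixWeights, Finset.sum_add_distrib, ← Finset.mul_sum, hμ]
  field_simp
  ring

/-- Here `λ_i = (1 - γ) μ_i + η` with `γ ≤ 1 / 2`. The three bounds serve integrability, the second
moment and stability; the last is AM-GM, `λ_i² ≥ 4 (1 - γ) μ_i η ≥ 2 η μ_i`. -/
theorem mixWeights_bounds (hd : 0 < d) (hη : 0 < η) (hηd : η ≤ 1 / (2 * (d : ℝ)))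
    (hγ : γ = η * d) {μ : Fin d → ℝ} (hμ : ∀ i, 0 < μ i) (i : Fin d) :
    η ≤ mixWeights γ μ i ∧ μ i ≤ 2 * mixWeights γ μ i ∧
      2 * (η * μ i) ≤ mixWeights γ μ i ^ 2 := by
  have hd' : (0 : ℝ) < d := by exact_mod_cast hd
  have hγ2 : γ ≤ 1 / 2 := by
    rw [le_div_iff₀ (by positivity)] at hηd
    rw [hγ]; linarith
  have e : mixWeights γ μ i = (1 - γ) * μ i + η := by
    rw [mixWeights, hγ]; field_simp
  have h := mul_nonneg (by linarith : 0 ≤ 1 / 2 - γ) (hμ i).le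
  rw [e]
  refine ⟨by nlinarith [hμ i], by nlinarith [hμ i], ?_⟩
  nlinarith [sq_nonneg ((1 - γ) * μ i - η), mul_nonneg h hη.le]

theorem measurable_coord {m : MeasurableSpace Ω} {u : Ω → OrthonormalBasis (Fin d) ℝ (Vec d)}
    (hu : ∀ i, Measurable[m] fun ω => u ω i) {A : Ω → Mat d}
    (hA : ∀ i j, Measurable[m] fun ω => A ω i j) (i j : Fin d) :
    Measurable[m] fun ω => coord (u ω) (A ω) i j := by
  have hu' : ∀ i a, Measurable[m] fun ω => u ω i a := fun i a =>
    (EuclideanSpace.proj (𝕜 := ℝ) a).continuous.measurable.comp (hu i)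
  simp only [coord_apply]
  exact Finset.measurable_sum _ fun b _ => (Finset.measurable_sum _ fun a _ =>
    (hu' i a).mul (hA a b)).mul (hu' j b)

theorem measurable_sparseLoss {m : MeasurableSpace Ω} {K : Ω → Mat d}
    (hK : ∀ i j, Measurable[m] fun ω => K ω i j) (i j : Fin d) (s : ℝ) :
    Measurable[m] fun ω => sparseLoss (K ω) i j s := by
  unfold sparseLoss
  split_ifs
  · exact hK i i
  · exact (((hK i i).add (hK j j)).add ((hK i j).const_mul (2 * s))).div_const 2

theorem measurable_estimateCoeff {m : MeasurableSpace Ω} {K : Ω → Mat d}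
    (hK : ∀ i j, Measurable[m] fun ω => K ω i j) {lam : Ω → Fin d → ℝ}
    (hlam : ∀ i, Measurable[m] fun ω => lam ω i) (i j : Fin d) (s : ℝ) :
    Measurable[m] fun ω => estimateCoeff (lam ω) (K ω) i j s :=
  ((measurable_sparseLoss hK i j s).const_mul _).div ((hlam i).mul (hlam j))

theorem abs_estimateCoeff_le (hη : 0 < η) {lam : Fin d → ℝ} (hlam : ∀ i, η ≤ lam i) {K : Mat d}
    (hK : ∀ i j, |K i j| ≤ 1) (i j : Fin d) {s : ℝ} (hs : s = -1 ∨ s = 1) :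
    |estimateCoeff lam K i j s| ≤ 2 / η ^ 2 := by
  have h1 : |(if i = j then 1 else s : ℝ)| = 1 := by
    rcases hs with rfl | rfl <;> split_ifs <;> simp
  have hp : ∀ k, 0 < lam k := fun k => hη.trans_le (hlam k)
  rw [estimateCoeff, abs_div, abs_mul, h1, one_mul, abs_of_pos (mul_pos (hp i) (hp j)), pow_two]
  exact div_le_div₀ (by norm_num) (abs_sparseLoss_le hK i j hs) (by positivity)
    (mul_le_mul (hlam i) (hlam j) hη.le (hp i).le)

end

/-! ### From one round to the regret -/

section
variable {Ω : Type*} {mΩ : MeasurableSpace Ω} {d : ℕ} {P : Measure Ω}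
  {ℱ : Filtration ℕ mΩ} {T : ℕ} {η γ : ℝ} {L : ℕ → Ω → Mat d}

namespace SparseRun

/-- The loss matrix of round `t` in the eigenbasis of `W t`. -/
noncomputable def eigenLoss (R : SparseRun P ℱ T η γ L) (t : ℕ) (ω : Ω) : Mat d :=
  coord (R.u t ω) (L t ω)

/-- The estimate `tr((W_t - U) L̃_t)` for the draws `i`, `j`, `s`. -/
noncomputable def gap (R : SparseRun P ℱ T η γ L) (U : Mat d) (t : ℕ) (i j : Fin d) (s : ℝ)
    (ω : Ω) : ℝ :=
  estimateCoeff (mixWeights γ (R.μ t ω)) (R.eigenLoss t ω) i j s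
    * coord (R.u t ω) (R.W t ω - U) i j

/-- The quadratic bound on the local divergence for the draws `i`, `j`, `s`. -/
noncomputable def localNorm (R : SparseRun P ℱ T η γ L) (t : ℕ) (i j : Fin d) (s : ℝ)
    (ω : Ω) : ℝ :=
  2 * (R.μ t ω i * R.μ t ω j)
    * estimateCoeff (mixWeights γ (R.μ t ω)) (R.eigenLoss t ω) i j s ^ 2

variable (R : SparseRun P ℱ T η γ L)

theorem abs_eigenLoss_le (hL : IsLossSequence ℱ T L) {t : ℕ} (ht : t ∈ Finset.Icc 1 T) (ω : Ω)
    (i j : Fin d) : |R.eigenLoss t ω i j| ≤ 1 :=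
  (abs_coord_le _ _ i j).trans (hL.bounded t ht ω)

theorem gap_le (hd : 0 < d) (hη : 0 < η) (hηd : η ≤ 1 / (2 * (d : ℝ))) (hγ : γ = η * d)
    (hL : IsLossSequence ℱ T L) {U : Mat d} (hU : U.IsSymm) (hUt : U.trace = 1)
    {t : ℕ} (ht : t ∈ Finset.Icc 1 T) (ω : Ω) :
    η * R.gap U t (R.I t ω) (R.J t ω) (R.s t ω) ω ≤
      potential U (R.W t ω) - potential U (R.W (t + 1) ω)
        + η ^ 2 * R.localNorm t (R.I t ω) (R.J t ω) (R.s t ω) ω := by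
  have hb := mixWeights_bounds hd hη hηd hγ (R.μ_pos hd ht ω)
  have hW := R.posDef hd ht ω
  have hWs : (R.W t ω).IsSymm := by
    have := hW.isHermitian.eq
    rwa [conjTranspose_eq_transpose_of_trivial] at this
  have hup := R.update t ht ω
  rw [frobInner_sparseAction _ (hL.symm t ht ω) _ _ (R.sign t ht ω)] at hup
  obtain ⟨hX, hdiv⟩ := posDef_and_divergence_le hη hW (R.coord_W ht ω) (R.μ_pos hd ht ω)
    (fun i => hη.trans_le (hb i).1) (fun i => (hb i).2.2) (R.abs_eigenLoss_le hL ht ω)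
    (R.I t ω) (R.J t ω) (R.sign t ht ω)
  have hstep := mirror_step hUt hup hX
  rw [trace_mul_sparseEstimate (R.u t ω) (hWs.sub hU)] at hstep
  refine hstep.trans ?_
  unfold localNorm
  exact add_le_add le_rfl hdiv

theorem sum_gap_le (hd : 0 < d) (hT : 0 < T) (hη : 0 < η) (hηd : η ≤ 1 / (2 * (d : ℝ)))
    (hγ : γ = η * d) (hL : IsLossSequence ℱ T L) {v : Vec d} (hv : ‖v‖ = 1) (ω : Ω) :
    ∑ t ∈ Finset.Icc 1 T, R.gap (comparator (1 / T) v) t (R.I t ω) (R.J t ω) (R.s t ω) ω ≤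
      d * Real.log T / η
        + η * ∑ t ∈ Finset.Icc 1 T, R.localNorm t (R.I t ω) (R.J t ω) (R.s t ω) ω := by
  have hT1 : (1 : ℝ) ≤ T := by exact_mod_cast hT
  have hT0 : (0 : ℝ) < T := by linarith
  set U := comparator (1 / (T : ℝ)) v
  have hsum := Finset.sum_le_sum fun t (ht : t ∈ Finset.Icc 1 T) =>
    R.gap_le hd hη hηd hγ hL (comparator_isSymm (1 / (T : ℝ)) v)
      (comparator_trace hd (1 / (T : ℝ)) hv) ht ω
  have htel : ∑ t ∈ Finset.Icc 1 T, (potential U (R.W t ω) - potential U (R.W (t + 1) ω))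
      = potential U (R.W 1 ω) - potential U (R.W (T + 1) ω) := by
    have h := Finset.sum_Ico_sub (fun t => potential U (R.W t ω)) (show 1 ≤ T + 1 by omega)
    have hI : Finset.Icc 1 T = Finset.Ico 1 (T + 1) := by ext; simp
    rw [hI, ← neg_inj, ← Finset.sum_neg_distrib]
    simp only [neg_sub]
    exact h
  -- With `θ = 1 / T` the bound `-d log θ` becomes `d log T`.
  have hpot := potential_sub_le hd (θ := 1 / (T : ℝ)) (by positivity)
    ((div_le_one hT0).2 hT1) hv (R.posDef_and_trace hd ω T le_rfl).1
  rw [← R.init ω] at hpot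
  rw [Finset.sum_add_distrib, htel, ← Finset.mul_sum, ← Finset.mul_sum] at hsum
  rw [one_div, Real.log_inv] at hpot
  have h : η * ∑ t ∈ Finset.Icc 1 T, R.gap U t (R.I t ω) (R.J t ω) (R.s t ω) ω ≤
      η * (d * Real.log T / η
        + η * ∑ t ∈ Finset.Icc 1 T, R.localNorm t (R.I t ω) (R.J t ω) (R.s t ω) ω) := by
    refine hsum.trans ?_
    have : η * (d * Real.log T / η) = d * Real.log T := by field_simp
    rw [mul_add, this, ← mul_assoc, ← pow_two]
    simp only [U, one_div]
    linarith
  exact le_of_mul_le_mul_left h hη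

theorem measurable_eigenLoss (hL : IsLossSequence ℱ T L) {t : ℕ} (ht : t ∈ Finset.Icc 1 T)
    (i j : Fin d) : Measurable[ℱ t] fun ω => R.eigenLoss t ω i j :=
  measurable_coord (R.measurable_u t ht) (hL.adapted t ht) i j

theorem measurable_coeff (hL : IsLossSequence ℱ T L) {t : ℕ} (ht : t ∈ Finset.Icc 1 T)
    (i j : Fin d) (s : ℝ) : Measurable[ℱ t] fun ω =>
      estimateCoeff (mixWeights γ (R.μ t ω)) (R.eigenLoss t ω) i j s :=
  measurable_estimateCoeff (R.measurable_eigenLoss hL ht)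
    (fun i => ((R.measurable_μ t ht i).const_mul _).add_const _) i j s

theorem μ_le_one (hd : 0 < d) {t : ℕ} (ht : t ∈ Finset.Icc 1 T) (ω : Ω) (i : Fin d) :
    R.μ t ω i ≤ 1 := by
  rw [← R.sum_μ hd ht ω]
  exact Finset.single_le_sum (f := R.μ t ω) (fun k _ => (R.μ_pos hd ht ω k).le) (Finset.mem_univ i)

theorem integral_gap [IsProbabilityMeasure P] (hd : 0 < d) (hη : 0 < η)
    (hηd : η ≤ 1 / (2 * (d : ℝ))) (hγ : γ = η * d) (hL : IsLossSequence ℱ T L) (U : Mat d)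
    {t : ℕ} (ht : t ∈ Finset.Icc 1 T) :
    Integrable (fun ω => R.gap U t (R.I t ω) (R.J t ω) (R.s t ω) ω) P ∧
    Integrable (fun ω => frobInner (R.W t ω - U) (L t ω)) P ∧
    ∫ ω, R.gap U t (R.I t ω) (R.J t ω) (R.s t ω) ω ∂P
      = ∫ ω, frobInner (R.W t ω - U) (L t ω) ∂P := by
  -- Measurability with respect to the past is known for the eigenvalues and eigenvectors, so `W t`
  -- enters only through its diagonal form.
  have hX : ∀ ω i j, coord (R.u t ω) (R.W t ω - U) i j
      = (if i = j then R.μ t ω i else 0) - coord (R.u t ω) U i j := fun ω i j => by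
    rw [coord_sub, R.coord_W ht, Matrix.sub_apply, diagonal_apply]
  have hD : ∀ i j, Measurable[ℱ t] fun ω => if i = j then R.μ t ω i else 0 := fun i j => by
    split_ifs
    · exact R.measurable_μ t ht i
    · exact measurable_const
  have hU : ∀ i j, Measurable[ℱ t] fun ω => coord (R.u t ω) U i j := fun i j =>
    measurable_coord (A := fun _ => U) (R.measurable_u t ht) (fun a b => measurable_const) i j
  have hXm : ∀ i j, Measurable[ℱ t] fun ω => coord (R.u t ω) (R.W t ω - U) i j := fun i j => by
    simp only [hX]
    exact (hD i j).sub (hU i j)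
  have hF : ∀ i j s, s = -1 ∨ s = 1 → Measurable[ℱ t] (R.gap U t i j s) := fun i j s _ =>
    (R.measurable_coeff hL ht i j s).mul (hXm i j)
  have hC : ∀ i j s, s = -1 ∨ s = 1 → ∀ ω,
      |R.gap U t i j s ω| ≤ 2 / η ^ 2 * (1 + spectralNorm U) := fun i j s hs ω => by
    have hb := mixWeights_bounds hd hη hηd hγ (R.μ_pos hd ht ω)
    rw [gap, abs_mul, hX]
    refine mul_le_mul (abs_estimateCoeff_le hη (fun i => (hb i).1) (R.abs_eigenLoss_le hL ht ω)
      i j hs) ((abs_sub _ _).trans (add_le_add ?_ (abs_coord_le _ _ i j))) (abs_nonneg _)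
      (by positivity)
    split_ifs
    · rw [abs_of_pos (R.μ_pos hd ht ω i)]
      exact R.μ_le_one hd ht ω i
    · simp
  obtain ⟨h1, h2, h3⟩ := R.integral_draw ht _ hF hC
  have e : (fun ω => ∑ i, ∑ j, mixWeights γ (R.μ t ω) i * mixWeights γ (R.μ t ω) j
      * ((R.gap U t i j (-1) ω + R.gap U t i j 1 ω) / 2))
      = fun ω => frobInner (R.W t ω - U) (L t ω) := by
    funext ω
    have hb := mixWeights_bounds hd hη hηd hγ (R.μ_pos hd ht ω)
    rw [← frobInner_coord (R.u t ω)]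
    exact mean_estimateCoeff_mul (fun i => hη.trans_le (hb i).1) _
  rw [e] at h2 h3
  exact ⟨h1, h2, h3⟩

theorem integrable_frobNorm_sq [IsFiniteMeasure P] (hL : IsLossSequence ℱ T L) {t : ℕ}
    (ht : t ∈ Finset.Icc 1 T) : Integrable (fun ω => frobNorm (L t ω) ^ 2) P := by
  simp only [frobNorm_sq, frobInner_eq_sum]
  refine integrable_finsetSum _ fun i _ => integrable_finsetSum _ fun j _ => ?_
  have hm : Measurable fun ω => L t ω i j := (hL.adapted t ht i j).mono (ℱ.le t) le_rfl
  refine Integrable.of_bound (hm.mul hm).aestronglyMeasurable 1 (ae_of_all _ fun ω => ?_)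
  have hle : |L t ω i j| ≤ 1 := by
    have h := abs_frobInner_outer_le (x := EuclideanSpace.single i (1 : ℝ))
      (y := EuclideanSpace.single j (1 : ℝ)) (by simp) (by simp) (L t ω)
    rw [frobInner_outer] at h
    have h' := h.trans (hL.bounded t ht ω)
    simpa [Pi.single_apply] using h'
  rw [Real.norm_eq_abs, abs_mul]
  exact mul_le_one₀ hle (abs_nonneg _) hle

theorem integral_localNorm_le [IsProbabilityMeasure P] (hd : 0 < d) (hη : 0 < η)
    (hηd : η ≤ 1 / (2 * (d : ℝ))) (hγ : γ = η * d) (hL : IsLossSequence ℱ T L)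
    {t : ℕ} (ht : t ∈ Finset.Icc 1 T) :
    Integrable (fun ω => R.localNorm t (R.I t ω) (R.J t ω) (R.s t ω) ω) P ∧
    ∫ ω, R.localNorm t (R.I t ω) (R.J t ω) (R.s t ω) ω ∂P
      ≤ 8 * d * ∫ ω, frobNorm (L t ω) ^ 2 ∂P := by
  have hF : ∀ i j s, s = -1 ∨ s = 1 → Measurable[ℱ t] (R.localNorm t i j s) := fun i j s _ =>
    (((R.measurable_μ t ht i).mul (R.measurable_μ t ht j)).const_mul 2).mul
      ((R.measurable_coeff hL ht i j s).pow_const 2)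
  have hC : ∀ i j s, s = -1 ∨ s = 1 → ∀ ω,
      |R.localNorm t i j s ω| ≤ 2 * (1 * 1) * (2 / η ^ 2) ^ 2 := fun i j s hs ω => by
    have hb := mixWeights_bounds hd hη hηd hγ (R.μ_pos hd ht ω)
    have hi := R.μ_pos hd ht ω i
    have hj := R.μ_pos hd ht ω j
    rw [localNorm, abs_mul, abs_of_nonneg (by positivity), abs_pow]
    have h1 := R.μ_le_one hd ht ω i
    have h2 := R.μ_le_one hd ht ω j
    have h3 := abs_estimateCoeff_le hη (fun i => (hb i).1) (R.abs_eigenLoss_le hL ht ω) i j hs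
    gcongr
  obtain ⟨h1, h2, h3⟩ := R.integral_draw ht _ hF hC
  refine ⟨h1, ?_⟩
  rw [h3, ← integral_const_mul]
  refine integral_mono h2 ((integrable_frobNorm_sq hL ht).const_mul _) fun ω => ?_
  have hb := mixWeights_bounds hd hη hηd hγ (R.μ_pos hd ht ω)
  simp only [frobNorm_sq]
  rw [← frobInner_coord (R.u t ω) (L t ω)]
  exact mean_quadratic_le (fun i => hη.trans_le (hb i).1) (fun i => (R.μ_pos hd ht ω i).le)
    fun i => (hb i).2.1

theorem integral_action_loss_le [IsProbabilityMeasure P] (hd : 0 < d) (hη : 0 < η)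
    (hηd : η ≤ 1 / (2 * (d : ℝ))) (hγ : γ = η * d) (hL : IsLossSequence ℱ T L) {θ : ℝ}
    (hθ : 0 ≤ θ) {v : Vec d} (hv : ‖v‖ = 1) {t : ℕ} (ht : t ∈ Finset.Icc 1 T) :
    ∫ ω, frobInner (outer (R.action t ω) (R.action t ω) - outer v v) (L t ω) ∂P
      ≤ ∫ ω, R.gap (comparator θ v) t (R.I t ω) (R.J t ω) (R.s t ω) ω ∂P + 2 * γ + 2 * θ := by
  let F : Fin d → Fin d → ℝ → Ω → ℝ := fun i j s ω =>
    sparseLoss (R.eigenLoss t ω) i j s - frobInner (outer v v) (L t ω)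
  have e : ∀ ω, frobInner (outer (R.action t ω) (R.action t ω) - outer v v) (L t ω)
      = F (R.I t ω) (R.J t ω) (R.s t ω) ω := fun ω => by
    rw [frobInner_sub_left, action,
      frobInner_sparseAction _ (hL.symm t ht ω) _ _ (R.sign t ht ω)]
    rfl
  have hF : ∀ i j s, s = -1 ∨ s = 1 → Measurable[ℱ t] (F i j s) := fun i j s _ => by
    refine (measurable_sparseLoss (R.measurable_eigenLoss hL ht) i j s).sub ?_
    simp only [frobInner_outer]
    exact Finset.measurable_sum _ fun a _ => Finset.measurable_sum _ fun b _ =>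
      ((hL.adapted t ht a b).const_mul _).mul_const _
  have hC : ∀ i j s, s = -1 ∨ s = 1 → ∀ ω, |F i j s ω| ≤ 2 + 1 := fun i j s hs ω =>
    (abs_sub _ _).trans (add_le_add (abs_sparseLoss_le (R.abs_eigenLoss_le hL ht ω) i j hs)
      ((abs_frobInner_outer_le hv hv _).trans (hL.bounded t ht ω)))
  obtain ⟨-, h2, h3⟩ := R.integral_draw ht F hF hC
  obtain ⟨-, g2, g3⟩ := R.integral_gap hd hη hηd hγ hL (comparator θ v) ht
  simp only [e]
  rw [h3, g3]
  have hc : ∫ ω, frobInner (R.W t ω - comparator θ v) (L t ω) ∂P + 2 * γ + 2 * θ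
      = ∫ ω, (frobInner (R.W t ω - comparator θ v) (L t ω) + (2 * γ + 2 * θ)) ∂P := by
    rw [integral_add g2 (integrable_const _), integral_const]
    simp [add_assoc]
  rw [hc]
  refine integral_mono h2 (g2.add (integrable_const _)) fun ω => ?_
  have hsum := sum_mixWeights hd γ (R.sum_μ hd ht ω)
  have hl := comparator_loss_le hd hθ hη.le hγ hv (hL.bounded t ht ω) (R.u t ω)
    (R.coord_W ht ω) (fun i => (R.μ_pos hd ht ω i).le) (R.sum_μ hd ht ω)
  have hm := mean_sparseLoss (K := R.eigenLoss t ω) hsum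
  have hs : ∑ i, ∑ j, mixWeights γ (R.μ t ω) i * mixWeights γ (R.μ t ω) j
      * ((F i j (-1) ω + F i j 1 ω) / 2)
      = ∑ i, mixWeights γ (R.μ t ω) i * R.eigenLoss t ω i i - frobInner (outer v v) (L t ω) := by
    rw [← hm]
    -- The comparator's loss does not depend on the draws; as the weights sum to one, it can be
    -- spread over the double sum.
    have h1 : frobInner (outer v v) (L t ω) = ∑ i, ∑ j, mixWeights γ (R.μ t ω) i
        * mixWeights γ (R.μ t ω) j * frobInner (outer v v) (L t ω) := by
      simp only [← Finset.sum_mul, ← Finset.mul_sum, hsum, one_mul, mul_one]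
    conv_rhs => rw [h1]
    rw [← Finset.sum_sub_distrib]
    refine Finset.sum_congr rfl fun i _ => ?_
    rw [← Finset.sum_sub_distrib]
    refine Finset.sum_congr rfl fun j _ => ?_
    simp only [F]
    ring
  show ∑ i, ∑ j, _ ≤ _
  rw [hs]
  exact hl.trans (add_assoc _ _ _).le

theorem regretAgainst_le [IsProbabilityMeasure P] (hd : 0 < d) (hη : 0 < η)
    (hηd : η ≤ 1 / (2 * (d : ℝ))) (hγ : γ = η * d) (hL : IsLossSequence ℱ T L)
    {v : Vec d} (hv : ‖v‖ = 1) :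
    regretAgainst P T R.action L v ≤ d * Real.log T / η + 2 * η * d * T + 2
      + 8 * η * d * ∑ t ∈ Finset.Icc 1 T, ∫ ω, frobNorm (L t ω) ^ 2 ∂P := by
  -- For `T = 0` the choice `θ = 1 / T` is meaningless, but the sums are empty and `Real.log 0 = 0`,
  -- leaving `0 ≤ 2`.
  rcases Nat.eq_zero_or_pos T with rfl | hT
  · simp [regretAgainst]
  have hT0 : (0 : ℝ) < T := by exact_mod_cast hT
  have hgi := fun t (ht : t ∈ Finset.Icc 1 T) =>
    (R.integral_gap hd hη hηd hγ hL (comparator (1 / T) v) ht).1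
  have hli := fun t (ht : t ∈ Finset.Icc 1 T) => R.integral_localNorm_le hd hη hηd hγ hL ht
  have h1 : regretAgainst P T R.action L v ≤ ∑ t ∈ Finset.Icc 1 T,
      ∫ ω, R.gap (comparator (1 / T) v) t (R.I t ω) (R.J t ω) (R.s t ω) ω ∂P
        + 2 * η * d * T + 2 := by
    refine (Finset.sum_le_sum fun t ht => R.integral_action_loss_le hd hη hηd hγ hL
      (θ := 1 / (T : ℝ)) (by positivity) hv ht).trans (le_of_eq ?_)
    rw [Finset.sum_add_distrib, Finset.sum_add_distrib]
    simp only [Finset.sum_const, Nat.card_Icc, add_tsub_cancel_right, nsmul_eq_mul, hγ]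
    field_simp
  have h2 : ∑ t ∈ Finset.Icc 1 T,
      ∫ ω, R.gap (comparator (1 / T) v) t (R.I t ω) (R.J t ω) (R.s t ω) ω ∂P
      ≤ d * Real.log T / η + η * ∑ t ∈ Finset.Icc 1 T,
        ∫ ω, R.localNorm t (R.I t ω) (R.J t ω) (R.s t ω) ω ∂P := by
    rw [← integral_finsetSum _ hgi, ← integral_finsetSum _ fun t ht => (hli t ht).1,
      ← integral_const_mul]
    have hint := (integrable_finsetSum _ fun t ht => (hli t ht).1).const_mul η
    have := integral_mono (integrable_finsetSum _ hgi)
      ((integrable_const (d * Real.log T / η)).add hint)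
      (fun ω => R.sum_gap_le hd hT hη hηd hγ hL hv ω)
    rw [integral_add' (integrable_const _) hint] at this
    simpa using this
  have h3 : ∑ t ∈ Finset.Icc 1 T, ∫ ω, R.localNorm t (R.I t ω) (R.J t ω) (R.s t ω) ω ∂P
      ≤ 8 * d * ∑ t ∈ Finset.Icc 1 T, ∫ ω, frobNorm (L t ω) ^ 2 ∂P := by
    rw [Finset.mul_sum]
    exact Finset.sum_le_sum fun t ht => (hli t ht).2
  have h4 := mul_le_mul_of_nonneg_left h3 hη.le
  linarith

end SparseRun
end

end BanditPCA

/-- A real `⨆` over an unbounded family takes the default value `0`; the boundedness clause ensures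
that the regret is a genuine supremum. -/
theorem theorem2 {Ω : Type*} {mΩ : MeasurableSpace Ω} (P : MeasureTheory.Measure Ω)
    [MeasureTheory.IsProbabilityMeasure P]
    (ℱ : MeasureTheory.Filtration ℕ mΩ)
    (d T : ℕ) (hd : 0 < d) (η γ : ℝ) (hη : 0 < η) (hηd : η ≤ 1 / (2 * (d : ℝ)))
    (hγ : γ = η * d)
    (L : ℕ → Ω → BanditPCA.Mat d) (hL : BanditPCA.IsLossSequence ℱ T L)
    (R : BanditPCA.SparseRun P ℱ T η γ L) :
    BddAbove (Set.range fun v : Metric.sphere (0 : BanditPCA.Vec d) 1 =>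
      BanditPCA.regretAgainst P T R.action L v) ∧
    BanditPCA.regret P T R.action L ≤
      d * Real.log T / η + 2 * η * d * T + 2
        + 8 * η * d * ∑ t ∈ Finset.Icc 1 T, ∫ ω, BanditPCA.frobNorm (L t ω) ^ 2 ∂P := by

  have hle : ∀ v : Metric.sphere (0 : BanditPCA.Vec d) 1, _ := fun v =>
    R.regretAgainst_le hd hη hηd hγ hL (v := v) (by simp)
  have : Nonempty (Metric.sphere (0 : BanditPCA.Vec d) 1) :=
    ⟨⟨EuclideanSpace.single ⟨0, hd⟩ 1, by simp⟩⟩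
  exact ⟨⟨_, Set.forall_mem_range.2 hle⟩, ciSup_le hle⟩
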